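/- Theorem 1.1. Let $f(z) = z + 1 + e^{-z}$ for $z \in \mathbb{C}$ (Fatou's function), let $f^n$ denote the $n$-th iterate of $f$, and let $$I(f) = \{z \in \mathbb{C} : f^n(z) \to \infty \text{ as } n \to \infty\}$$ be the escaping set of $f$. Then $I(f)$ is a spider's web; that is, $I(f)$ is connected and there exists a sequence $(G_n)_{n \in \mathbb{N}}$ of bounded simply connected domains in $\mathbb{C}$ such that $G_n \subset G_{n+1}$ and $\partial G_n \subset I(f)$ for all $n \in \mathbb{N}$, and $\bigcup_{n \in \mathbb{N}} G_n = \mathbb{C}$. -/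

import Mathlib

/-- Fatou's function `z ↦ z + 1 + e^{-z}`. -/
noncomputable def fatouFunction (z : ℂ) : ℂ := z + 1 + Complex.exp (-z)

/-- The escaping set of `f`: all `z` with `|f^n(z)| → ∞` as `n → ∞`, where `f^n` is the `n`-th
iterate. (`Bornology.cobounded ℂ` is the filter of neighbourhoods of `∞`.) -/
def escapingSet (f : ℂ → ℂ) : Set ℂ :=
  {z | Filter.Tendsto (fun n : ℕ => f^[n] z) Filter.atTop (Bornology.cobounded ℂ)}

/-- A set `E ⊆ ℂ` is an (infinite) spider's web if it is connected and contains the boundaries of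
an increasing sequence of bounded simply connected domains whose union is `ℂ`.
(`IsSimplyConnected` includes that the set is nonempty and path connected.) -/
def IsSpidersWeb (E : Set ℂ) : Prop :=
  IsConnected E ∧
    ∃ G : ℕ → Set ℂ,
      (∀ n, IsOpen (G n) ∧ IsSimplyConnected (G n) ∧ Bornology.IsBounded (G n)) ∧
      (∀ n, G n ⊆ G (n + 1)) ∧
      (∀ n, frontier (G n) ⊆ E) ∧
      ⋃ n, G n = Set.univ

/-!
Fatou's function `f`: the half-plane `x > 0` escapes. The iterated preimages of `x > collarLevel`
form a connected dense subset of the escaping set. The domains `fatouDomain n` are unions of pullbacks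
of truncated half-strips along the tracts `fatouTract k`, each mapped bijectively onto `x < 1`;
their boundaries consist of escaping points.
-/
open Set Topology unitInterval Filter Metric

/-! ### Gluing simply connected sets -/

/-- Two paths inside a simply connected set with the same endpoints are homotopic. -/
theorem IsSimplyConnected.path_homotopic {X : Type*} [TopologicalSpace X] {A : Set X}
    (hA : IsSimplyConnected A) {x y : X} (p q : Path x y) (hp : ∀ t, p t ∈ A)
    (hq : ∀ t, q t ∈ A) : p.Homotopic q := by
  have := hA.simplyConnectedSpace
  have hx : x ∈ A := by simpa using hp 0
  have hy : y ∈ A := by simpa using hp 1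
  let p' : Path (⟨x, hx⟩ : A) ⟨y, hy⟩ :=
    { toFun := fun t => ⟨p t, hp t⟩
      source' := by simp
      target' := by simp }
  let q' : Path (⟨x, hx⟩ : A) ⟨y, hy⟩ :=
    { toFun := fun t => ⟨q t, hq t⟩
      source' := by simp
      target' := by simp }
  exact (SimplyConnectedSpace.paths_homotopic p' q').map ⟨Subtype.val, continuous_subtype_val⟩

/-- The easy case of van Kampen. If every `x` has a class `c x` of paths from `a`, compatible with
paths inside `A` or inside `B`, then subdividing an arbitrary path gives `[p] = (c x)⁻¹ (c y)`,
which depends only on the endpoints. -/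
theorem SimplyConnectedSpace.of_isOpen_cover {X : Type*} [TopologicalSpace X] {A B : Set X}
    (hAo : IsOpen A) (hBo : IsOpen B) (hA : IsSimplyConnected A) (hB : IsSimplyConnected B)
    (hAB : IsPathConnected (A ∩ B)) (hU : ∀ x, x ∈ A ∨ x ∈ B) : SimplyConnectedSpace X := by
  obtain ⟨a, haA, haB⟩ := hAB.nonempty
  have hpc : PathConnectedSpace X := by
    rw [pathConnectedSpace_iff_univ]
    have : A ∪ B = univ := eq_univ_of_forall hU
    rw [← this]
    exact hA.isPathConnected.union hB.isPathConnected hAB.nonempty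
  -- For `x` in both sets, a path inside `A ∩ B` represents both classes; otherwise one of the two
  -- conditions is vacuous.
  have hc : ∀ x : X, ∃ c : Path.Homotopic.Quotient a x,
      (∀ p : Path a x, (∀ t, p t ∈ A) → .mk p = c) ∧
      (∀ p : Path a x, (∀ t, p t ∈ B) → .mk p = c) := by
    intro x
    by_cases hxA : x ∈ A
    · by_cases hxB : x ∈ B
      · obtain ⟨γ, hγ⟩ := hAB.joinedIn a ⟨haA, haB⟩ x ⟨hxA, hxB⟩
        exact ⟨.mk γ, fun p hp => Path.Homotopic.Quotient.eq.2
            (hA.path_homotopic _ _ hp fun t => (hγ t).1),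
          fun p hp => Path.Homotopic.Quotient.eq.2
            (hB.path_homotopic _ _ hp fun t => (hγ t).2)⟩
      · obtain ⟨γ, hγ⟩ := hA.isPathConnected.joinedIn a haA x hxA
        refine ⟨.mk γ, fun p hp => Path.Homotopic.Quotient.eq.2
            (hA.path_homotopic _ _ hp hγ), fun p hp => absurd ?_ hxB⟩
        simpa using hp 1
    · have hxB : x ∈ B := (hU x).resolve_left hxA
      obtain ⟨γ, hγ⟩ := hB.isPathConnected.joinedIn a haB x hxB
      refine ⟨.mk γ, fun p hp => absurd ?_ hxA, fun p hp => Path.Homotopic.Quotient.eq.2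
            (hB.path_homotopic _ _ hp hγ)⟩
      simpa using hp 1
  choose c hcA hcB using hc
  have trans_mem : ∀ {S : Set X} {x y z : X} (p : Path x y) (q : Path y z),
      (∀ t, p t ∈ S) → (∀ t, q t ∈ S) → ∀ t, (p.trans q) t ∈ S := by
    intro S x y z p q hp hq t
    rw [Path.trans_apply]
    split_ifs
    exacts [hp _, hq _]
  have step : ∀ {x y : X} (q : Path x y), ((∀ t, q t ∈ A) ∨ (∀ t, q t ∈ B)) →
      (c x).trans (.mk q) = c y := by
    rintro x y q (hq | hq)
    · obtain ⟨γ, hγ⟩ := hA.isPathConnected.joinedIn a haA x (by simpa using hq 0)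
      rw [← hcA x γ hγ, ← Path.Homotopic.Quotient.mk_trans]
      exact hcA y _ (trans_mem _ _ hγ hq)
    · obtain ⟨γ, hγ⟩ := hB.isPathConnected.joinedIn a haB x (by simpa using hq 0)
      rw [← hcB x γ hγ, ← Path.Homotopic.Quotient.mk_trans]
      exact hcB y _ (trans_mem _ _ hγ hq)
  have cast_aux : ∀ {x x' y y' : X} (hx : x' = x) (hy : y' = y)
      (P : Path.Homotopic.Quotient x y), (c x').trans (P.cast hx hy) = c y' →
      (c x).trans P = c y := by
    intro x x' y y' hx hy P h
    subst hx hy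
    simpa using h
  have main : ∀ {x y : X} (p : Path x y), (c x).trans (.mk p) = c y := by
    intro x y p
    obtain ⟨t, ht0, htm, ⟨N, hN⟩, hcov⟩ :=
      exists_monotone_Icc_subset_open_cover_unitInterval
        (c := fun b : Bool => p ⁻¹' (if b then A else B))
        (by intro b; cases b <;> simp [hAo.preimage p.continuous, hBo.preimage p.continuous])
        (by
          intro s _
          rcases hU (p s) with h | h
          · exact mem_iUnion.2 ⟨true, by simpa using h⟩
          · exact mem_iUnion.2 ⟨false, by simpa using h⟩)
    have claim : ∀ n, (c (p 0)).trans (.mk (p.subpath 0 (t n))) = c (p (t n)) := by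
      intro n
      induction n with
      | zero =>
        rw [ht0, Path.subpath_self]
        simp
      | succ n ih =>
        have h1 : Path.Homotopic.Quotient.mk (p.subpath 0 (t (n + 1))) =
            (Path.Homotopic.Quotient.mk (p.subpath 0 (t n))).trans
              (.mk (p.subpath (t n) (t (n + 1)))) := by
          rw [← Path.Homotopic.Quotient.mk_trans]
          exact Path.Homotopic.Quotient.eq.2 ⟨(Path.Homotopy.subpathTransSubpath p _ _ _).symm⟩
        rw [h1, ← Path.Homotopic.Quotient.trans_assoc, ih]
        apply step
        obtain ⟨b, hb⟩ := hcov n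
        have hr : ∀ s, p.subpath (t n) (t (n + 1)) s ∈ (if b then A else B) := by
          intro s
          have : p.subpath (t n) (t (n + 1)) s ∈ range (p.subpath (t n) (t (n + 1))) :=
            mem_range_self s
          rw [Path.range_subpath_of_le _ _ _ (htm n.le_succ)] at this
          obtain ⟨u, hu, hu'⟩ := this
          rw [← hu']
          exact hb hu
        cases b
        · exact Or.inr (by simpa using hr)
        · exact Or.inl (by simpa using hr)
    have h := claim N
    rw [hN N le_rfl, Path.subpath_zero_one, Path.Homotopic.Quotient.mk_cast] at h
    exact cast_aux _ _ _ h
  rw [simply_connected_iff_paths_homotopic']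
  refine ⟨hpc, fun {x y} p q => ?_⟩
  rw [← Path.Homotopic.Quotient.eq]
  have h := (main p).trans (main q).symm
  have h2 := congrArg (fun P => (c x).symm.trans P) h
  simpa [← Path.Homotopic.Quotient.trans_assoc] using h2

theorem IsSimplyConnected.preimage_val {X : Type*} [TopologicalSpace X] {A S : Set X}
    (hA : IsSimplyConnected A) (hAS : A ⊆ S) :
    IsSimplyConnected ((↑) ⁻¹' A : Set S) := by
  rw [← (IsEmbedding.subtypeVal (p := (· ∈ S))).isSimplyConnected_image]
  simpa [Subtype.image_preimage_coe, inter_eq_right.2 hAS] using hA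

/-- The union of two open simply connected sets whose intersection is path connected is simply
connected. -/
theorem IsSimplyConnected.union {X : Type*} [TopologicalSpace X] {A B : Set X}
    (hA : IsSimplyConnected A) (hB : IsSimplyConnected B) (hAo : IsOpen A) (hBo : IsOpen B)
    (hAB : IsPathConnected (A ∩ B)) : IsSimplyConnected (A ∪ B) := by
  refine SimplyConnectedSpace.of_isOpen_cover (X := ↥(A ∪ B)) (A := Subtype.val ⁻¹' A)
    (B := Subtype.val ⁻¹' B)
    (hAo.preimage continuous_subtype_val) (hBo.preimage continuous_subtype_val)
    (hA.preimage_val subset_union_left) (hB.preimage_val subset_union_right) ?_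
    (fun x => x.2.imp id id)
  rw [← preimage_inter]
  exact hAB.preimage_coe (inter_subset_left.trans subset_union_left)

/-- Attaching finitely many open simply connected pieces, which meet each other only inside the
open simply connected set `A`, along path connected sets. -/
theorem IsSimplyConnected.union_biUnion {X ι : Type*} [TopologicalSpace X] {A : Set X}
    {B : ι → Set X} (hA : IsSimplyConnected A) (hAo : IsOpen A) (s : Finset ι)
    (hB : ∀ i ∈ s, IsSimplyConnected (B i)) (hBo : ∀ i ∈ s, IsOpen (B i))
    (hAB : ∀ i ∈ s, IsPathConnected (A ∩ B i))
    (hBB : ∀ i ∈ s, ∀ j ∈ s, i ≠ j → B i ∩ B j ⊆ A) :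
    IsSimplyConnected (A ∪ ⋃ i ∈ s, B i) := by
  classical
  induction s using Finset.induction_on with
  | empty => simpa using hA
  | insert i s hi ih =>
    have ih := ih (fun j hj => hB j (Finset.mem_insert_of_mem hj))
      (fun j hj => hBo j (Finset.mem_insert_of_mem hj))
      (fun j hj => hAB j (Finset.mem_insert_of_mem hj))
      (fun j hj k hk => hBB j (Finset.mem_insert_of_mem hj) k (Finset.mem_insert_of_mem hk))
    have hi' := Finset.mem_insert_self i s
    have h1 : A ∪ ⋃ j ∈ insert i s, B j = (A ∪ ⋃ j ∈ s, B j) ∪ B i := by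
      rw [Finset.set_biUnion_insert, union_comm (B i), union_assoc]
    have h2 : (A ∪ ⋃ j ∈ s, B j) ∩ B i = A ∩ B i := by
      apply Subset.antisymm
      · rintro x ⟨hx | hx, hxi⟩
        · exact ⟨hx, hxi⟩
        · simp only [mem_iUnion] at hx
          obtain ⟨j, hj, hxj⟩ := hx
          exact ⟨hBB j (Finset.mem_insert_of_mem hj) i hi' (by rintro rfl; exact hi hj)
            ⟨hxj, hxi⟩, hxi⟩
      · exact inter_subset_inter_left _ subset_union_left
    rw [h1]
    refine ih.union (hB i hi') (hAo.union (isOpen_biUnion fun j hj =>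
      hBo j (Finset.mem_insert_of_mem hj))) (hBo i hi') ?_
    rw [h2]
    exact hAB i hi'

/-- An increasing union of open simply connected sets is simply connected. -/
theorem IsSimplyConnected.iUnion_of_monotone {X : Type*} [TopologicalSpace X] {S : ℕ → Set X}
    (hS : ∀ n, IsSimplyConnected (S n)) (ho : ∀ n, IsOpen (S n)) (hm : Monotone S) :
    IsSimplyConnected (⋃ n, S n) := by
  rw [isSimplyConnected_iff_exists_homotopy_refl_forall_mem]
  constructor
  · obtain ⟨x, hx⟩ := (hS 0).nonempty
    refine ⟨x, mem_iUnion.2 ⟨0, hx⟩, fun {y} hy => ?_⟩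
    obtain ⟨n, hn⟩ := mem_iUnion.1 hy
    exact ((hS n).isPathConnected.joinedIn x (hm (Nat.zero_le n) hx) y hn).mono
      (subset_iUnion S n)
  · intro x p hp
    -- By compactness the loop already lies in one `S n` and contracts there.
    obtain ⟨n, hn⟩ := (isCompact_range p.continuous).elim_directed_cover S ho
      (by rintro _ ⟨t, rfl⟩; exact hp t) hm.directed_le
    obtain ⟨F, hF⟩ := ((isSimplyConnected_iff_exists_homotopy_refl_forall_mem.1 (hS n)).2 x p
      fun t => hn (mem_range_self t))
    exact ⟨F, fun t => mem_iUnion.2 ⟨n, hF t⟩⟩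

theorem Convex.isSimplyConnected {E : Type*} [AddCommGroup E] [TopologicalSpace E]
    [IsTopologicalAddGroup E] [Module ℝ E] [ContinuousSMul ℝ E] {s : Set E}
    (hs : Convex ℝ s) (hne : s.Nonempty) : IsSimplyConnected s := by
  have := hs.contractibleSpace hne
  exact SimplyConnectedSpace.ofContractible s

/-- A set with a continuous self-map `r` onto a convex subset such that every point can be joined
to its image by a segment is simply connected. -/
theorem IsSimplyConnected.of_segment_retraction {E : Type*} [AddCommGroup E] [TopologicalSpace E]
    [IsTopologicalAddGroup E] [Module ℝ E] [ContinuousSMul ℝ E] {s l : Set E} {r : E → E}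
    (hr : Continuous r) (hl : Convex ℝ l) (hls : l ⊆ s) (hne : s.Nonempty)
    (hrl : ∀ z ∈ s, r z ∈ l) (hseg : ∀ z ∈ s, segment ℝ z (r z) ⊆ s) :
    IsSimplyConnected s := by
  obtain ⟨z₀, hz₀⟩ := hne
  have hhom : ∀ f g : C(s, s), (∀ z, segment ℝ (f z : E) (g z) ⊆ s) → f.Homotopic g := by
    intro f g h
    refine ⟨⟨⟨fun x => ⟨AffineMap.lineMap (f x.2 : E) (g x.2) (x.1 : ℝ), h x.2 ?_⟩, ?_⟩, ?_, ?_⟩⟩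
    · rw [segment_eq_image_lineMap]
      exact ⟨x.1, x.1.2, rfl⟩
    · refine Continuous.subtype_mk ?_ _
      simp only [AffineMap.lineMap_apply, vsub_eq_sub, vadd_eq_add]
      fun_prop
    · intro x; simp
    · intro x; simp
  let R : C(s, s) := ⟨fun z => ⟨r z, hls (hrl z z.2)⟩, by fun_prop⟩
  have h1 : (ContinuousMap.id s).Homotopic R := hhom _ _ fun z => hseg z z.2
  have h2 : R.Homotopic (ContinuousMap.const s ⟨r z₀, hls (hrl z₀ hz₀)⟩) :=
    hhom _ _ fun z => (hl.segment_subset (hrl z z.2) (hrl z₀ hz₀)).trans hls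
  have : ContractibleSpace s := (contractible_iff_id_nullhomotopic s).2 ⟨_, h1.trans h2⟩
  exact SimplyConnectedSpace.ofContractible s

/-! ### Elementary estimates and escape to the right -/

theorem fatouFunction_re (z : ℂ) :
    (fatouFunction z).re = z.re + 1 + Real.exp (-z.re) * Real.cos z.im := by
  simp [fatouFunction, Complex.exp_re]

theorem fatouFunction_im (z : ℂ) :
    (fatouFunction z).im = z.im - Real.exp (-z.re) * Real.sin z.im := by
  simp [fatouFunction, Complex.exp_im]
  ring

@[fun_prop]
theorem continuous_fatouFunction : Continuous fatouFunction := by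
  unfold fatouFunction
  fun_prop

theorem hasDerivAt_fatouFunction (z : ℂ) :
    HasDerivAt fatouFunction (1 - Complex.exp (-z)) z := by
  have h := ((hasDerivAt_id z).add_const (1 : ℂ)).add ((hasDerivAt_neg z).cexp)
  convert! h using 1
  ring

theorem differentiable_fatouFunction : Differentiable ℂ fatouFunction :=
  fun z => (hasDerivAt_fatouFunction z).differentiableAt

/-- `f` moves the real part by at least `1 - e^{-x}`. -/
theorem le_re_fatouFunction (z : ℂ) :
    z.re + 1 - Real.exp (-z.re) ≤ (fatouFunction z).re := by
  rw [fatouFunction_re]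
  nlinarith [Real.exp_pos (-z.re), Real.neg_one_le_cos z.im]

theorem abs_im_fatouFunction_le (z : ℂ) :
    |(fatouFunction z).im| ≤ |z.im| + Real.exp (-z.re) := by
  rw [fatouFunction_im]
  have h1 : |Real.exp (-z.re) * Real.sin z.im| ≤ Real.exp (-z.re) := by
    rw [abs_mul, abs_of_pos (Real.exp_pos _)]
    exact mul_le_of_le_one_right (Real.exp_pos _).le (Real.abs_sin_le_one _)
  exact (abs_sub _ _).trans (by linarith)

theorem exp_neg_re_eq (z : ℂ) : Real.exp (-z.re) = ‖fatouFunction z - z - 1‖ := by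
  have : fatouFunction z - z - 1 = Complex.exp (-z) := by
    unfold fatouFunction; ring
  rw [this, Complex.norm_exp, Complex.neg_re]

/-- Turns bounds on `f z` and `z.im` into a lower bound for `z.re`, because the exponential outgrows
`|z.re|`. -/
theorem exp_neg_re_le (z : ℂ) :
    Real.exp (-z.re) ≤ |(fatouFunction z).re| + |(fatouFunction z).im| + |z.re| + |z.im| + 1 := by
  rw [exp_neg_re_eq]
  have h1 := norm_sub_le (fatouFunction z - z) 1
  have h2 := norm_sub_le (fatouFunction z) z
  have h3 := Complex.norm_le_abs_re_add_abs_im (fatouFunction z)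
  have h4 := Complex.norm_le_abs_re_add_abs_im z
  rw [norm_one] at h1
  linarith

theorem two_le_re_of_cos_eq_one {z : ℂ} (h : Real.cos z.im = 1) : 2 ≤ (fatouFunction z).re := by
  rw [fatouFunction_re, h]
  have := Real.add_one_le_exp (-z.re)
  linarith

theorem le_re_of_nonneg {z : ℂ} (h : 0 ≤ z.re) : z.re ≤ (fatouFunction z).re := by
  have h1 := le_re_fatouFunction z
  have h2 : Real.exp (-z.re) ≤ 1 := Real.exp_le_one_iff.2 (by linarith)
  linarith

theorem mem_escapingSet_map_iff {g : ℂ → ℂ} {z : ℂ} :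
    g z ∈ escapingSet g ↔ z ∈ escapingSet g := by
  unfold escapingSet
  simp only [mem_ofPred_eq, ← Function.iterate_succ_apply]
  exact tendsto_add_atTop_iff_nat (f := fun n => g^[n] z) 1

theorem mem_escapingSet_iterate_iff {g : ℂ → ℂ} {z : ℂ} (n : ℕ) :
    g^[n] z ∈ escapingSet g ↔ z ∈ escapingSet g := by
  induction n with
  | zero => rfl
  | succ n ih => rw [Function.iterate_succ_apply', mem_escapingSet_map_iff, ih]

/-- Real parts never fall below the initial `x`, so every step gains at least `1 - e^{-x} > 0`. -/
theorem mem_escapingSet_of_re_pos {z : ℂ} (h : 0 < z.re) : z ∈ escapingSet fatouFunction := by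
  have hδ : 0 < 1 - Real.exp (-z.re) := by
    have : Real.exp (-z.re) < 1 := Real.exp_lt_one_iff.2 (by linarith)
    linarith
  have key : ∀ n : ℕ, z.re + n * (1 - Real.exp (-z.re)) ≤ (fatouFunction^[n] z).re := by
    intro n
    induction n with
    | zero => simp
    | succ n ih =>
      rw [Function.iterate_succ_apply']
      have h1 := le_re_fatouFunction (fatouFunction^[n] z)
      have h2 : z.re ≤ (fatouFunction^[n] z).re := by
        have : (0 : ℝ) ≤ n * (1 - Real.exp (-z.re)) := by positivity
        linarith
      have h3 : Real.exp (-(fatouFunction^[n] z).re) ≤ Real.exp (-z.re) :=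
        Real.exp_le_exp.2 (by linarith)
      push_cast
      linarith
  have h1 : Tendsto (fun n : ℕ => z.re + n * (1 - Real.exp (-z.re))) atTop atTop :=
    tendsto_atTop_add_const_left _ _ (tendsto_natCast_atTop_atTop.atTop_mul_const hδ)
  refine tendsto_norm_atTop_iff_cobounded.1 (tendsto_atTop_mono (fun n => ?_) h1)
  exact (key n).trans ((le_abs_self _).trans (Complex.abs_re_le_norm _))

theorem exists_frequently_norm_le {z : ℂ} (h : z ∉ escapingSet fatouFunction) :
    ∃ r : ℝ, ∀ N, ∃ n ≥ N, ‖fatouFunction^[n] z‖ ≤ r := by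
  by_contra! hr
  refine h (tendsto_norm_atTop_iff_cobounded.1 (tendsto_atTop.2 fun r => ?_))
  obtain ⟨N, hN⟩ := hr r
  exact eventually_atTop.2 ⟨N, fun n hn => (hN n hn).le⟩

/-! ### Tracts and inverse branches -/

/-- The part of the strip `2πk < y < 2π(k+1)` which `f` maps to the half-plane `x < 1`. -/
def fatouTract (k : ℤ) : Set ℂ :=
  {z | 2 * Real.pi * k < z.im ∧ z.im < 2 * Real.pi * (k + 1) ∧ (fatouFunction z).re < 1}

theorem isOpen_fatouTract (k : ℤ) : IsOpen (fatouTract k) := by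
  unfold fatouTract
  exact (isOpen_lt continuous_const Complex.continuous_im).inter
    ((isOpen_lt Complex.continuous_im continuous_const).inter
      (isOpen_lt (Complex.continuous_re.comp continuous_fatouFunction) continuous_const))

theorem im_ne_of_re_lt_one {z : ℂ} (h : (fatouFunction z).re < 1) (k : ℤ) :
    z.im ≠ 2 * Real.pi * k := by
  intro h1
  have : Real.cos z.im = 1 := by
    rw [h1, mul_comm, Real.cos_int_mul_two_pi]
  linarith [two_le_re_of_cos_eq_one this]

theorem re_lt_of_re_lt {z : ℂ} {c : ℝ} (hc : 0 ≤ c) (h : (fatouFunction z).re < c) : z.re < c := by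
  by_contra! hz
  linarith [le_re_of_nonneg (hc.trans hz)]

theorem exists_mem_fatouTract {z : ℂ} (h : (fatouFunction z).re < 1) :
    ∃ k, z ∈ fatouTract k := by
  have hpi : 0 < 2 * Real.pi := by positivity
  refine ⟨⌊z.im / (2 * Real.pi)⌋, lt_of_le_of_ne ?_ (im_ne_of_re_lt_one h _).symm, ?_, h⟩
  · have := Int.floor_le (z.im / (2 * Real.pi))
    rw [le_div_iff₀ hpi] at this
    linarith
  · have := Int.lt_floor_add_one (z.im / (2 * Real.pi))
    rw [div_lt_iff₀ hpi] at this
    linarith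

theorem fatouTract_eq_of_mem {z : ℂ} {j k : ℤ} (hj : z ∈ fatouTract j) (hk : z ∈ fatouTract k) :
    j = k := by
  have hpi : 0 < 2 * Real.pi := by positivity
  have h1 : (j : ℝ) < k + 1 := lt_of_mul_lt_mul_left (hj.1.trans hk.2.1) hpi.le
  have h2 : (k : ℝ) < j + 1 := lt_of_mul_lt_mul_left (hk.1.trans hj.2.1) hpi.le
  norm_cast at h1 h2
  omega

/-- With `e = e^{-x}`, the square is `1 - 2e cos y + e²`. The hypothesis says `-e cos y ≥ x`, and
`e² ≥ 1 - 2x`. -/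
theorem two_le_normSq_deriv {z : ℂ} (h : (fatouFunction z).re ≤ 1) :
    2 ≤ ‖1 - Complex.exp (-z)‖ ^ 2 := by
  rw [← Complex.normSq_eq_norm_sq, Complex.normSq_apply]
  simp only [Complex.sub_re, Complex.one_re, Complex.sub_im, Complex.one_im, Complex.exp_re,
    Complex.exp_im, Complex.neg_re, Complex.neg_im, Real.cos_neg, Real.sin_neg]
  rw [fatouFunction_re] at h
  set e := Real.exp (-z.re)
  have h1 : e ^ 2 = Real.exp (-2 * z.re) := by
    rw [← Real.exp_nat_mul]; congr 1; push_cast; ring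
  have h2 := Real.add_one_le_exp (-2 * z.re)
  nlinarith [Real.sin_sq_add_cos_sq z.im]

theorem deriv_ne_zero_of_mem {z : ℂ} (h : (fatouFunction z).re ≤ 1) :
    1 - Complex.exp (-z) ≠ 0 := by
  intro h0
  have := two_le_normSq_deriv h
  rw [h0] at this
  norm_num at this

/-- Sequences in a tract whose images converge to a point of `x < 1` subconverge in the tract. -/
theorem exists_subseq_tendsto_of_mem_fatouTract {k : ℤ} {z : ℕ → ℂ} (hz : ∀ n, z n ∈ fatouTract k)
    {w : ℂ} (hw : w.re < 1) (hlim : Tendsto (fun n => fatouFunction (z n)) atTop (𝓝 w)) :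
    ∃ a ∈ fatouTract k, fatouFunction a = w ∧
      ∃ φ : ℕ → ℕ, StrictMono φ ∧ Tendsto (z ∘ φ) atTop (𝓝 a) := by
  have hbdd : ∃ R, ∀ n, ‖z n‖ ≤ R := by
    obtain ⟨C, hC⟩ := hlim.norm.bddAbove_range
    have hC' : ∀ n, ‖fatouFunction (z n)‖ ≤ C := fun n => hC (mem_range_self n)
    set B : ℝ := 2 * Real.pi * (|(k : ℝ)| + 1)
    have hB : ∀ n, |(z n).im| ≤ B := by
      intro n
      have hpi : 0 < 2 * Real.pi := by positivity
      obtain ⟨h1, h2, -⟩ := hz n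
      rw [abs_le]
      constructor
      · have : -(|(k : ℝ)| + 1) ≤ k := by linarith [neg_abs_le (k : ℝ)]
        nlinarith
      · have : (k : ℝ) + 1 ≤ |(k : ℝ)| + 1 := by linarith [le_abs_self (k : ℝ)]
        nlinarith
    have hre : ∀ n, |(z n).re| ≤ 2 * C + B + 4 := by
      intro n
      have h0 : 0 ≤ C := (norm_nonneg _).trans (hC' 0)
      have hB0 : 0 ≤ B := (abs_nonneg _).trans (hB 0)
      have h1 := re_lt_of_re_lt zero_le_one (hz n).2.2
      rcases le_or_gt 0 (z n).re with h2 | h2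
      · rw [abs_of_nonneg h2]
        linarith
      · have h3 := exp_neg_re_le (z n)
        have h4 := (Complex.abs_re_le_norm _).trans (hC' n)
        have h5 := (Complex.abs_im_le_norm _).trans (hC' n)
        -- The linear terms in `-x` cancel, leaving a bound on `x²`.
        have h6 := Real.quadratic_le_exp_of_nonneg (x := -(z n).re) (by linarith)
        rw [abs_of_neg h2] at h3 ⊢
        nlinarith [hB n, sq_nonneg (-(z n).re - 2)]
    exact ⟨2 * C + B + 4 + B, fun n => (Complex.norm_le_abs_re_add_abs_im _).trans
      (add_le_add (hre n) (hB n))⟩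
  obtain ⟨R, hR⟩ := hbdd
  obtain ⟨a, -, φ, hφ, hlim'⟩ := tendsto_subseq_of_bounded (isBounded_closedBall (x := (0 : ℂ)) (r := R))
    (x := z) (fun n => by simpa using hR n)
  have hfa : fatouFunction a = w :=
    tendsto_nhds_unique ((continuous_fatouFunction.tendsto a).comp hlim')
      (hlim.comp hφ.tendsto_atTop)
  have hare : (fatouFunction a).re < 1 := by rw [hfa]; exact hw
  have him : Tendsto (fun n => (z (φ n)).im) atTop (𝓝 a.im) :=
    (Complex.continuous_im.tendsto a).comp hlim'
  -- The limit cannot lie on an edge of the strip, since `Re f ≥ 2` there.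
  refine ⟨a, ⟨lt_of_le_of_ne ?_ (im_ne_of_re_lt_one hare k).symm, lt_of_le_of_ne ?_ ?_, hare⟩,
    hfa, φ, hφ, hlim'⟩
  · exact ge_of_tendsto' him fun n => (hz _).1.le
  · exact le_of_tendsto' him fun n => (hz _).2.1.le
  · exact_mod_cast im_ne_of_re_lt_one hare (k + 1)

theorem isPreconnected_re_lt (c : ℝ) : IsPreconnected {w : ℂ | w.re < c} :=
  (convex_halfSpace_re_lt c).isPreconnected

/-- The centre `(2k+1)πi` of a tract is a fixed point. -/
theorem fatouFunction_center (k : ℤ) :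
    fatouFunction ⟨0, 2 * Real.pi * k + Real.pi⟩ = ⟨0, 2 * Real.pi * k + Real.pi⟩ := by
  have h : (2 * Real.pi * k + Real.pi) = Real.pi + k * (2 * Real.pi) := by ring
  apply Complex.ext
  · rw [fatouFunction_re]
    simp [h]
  · rw [fatouFunction_im]
    simp [h]

theorem center_mem_fatouTract (k : ℤ) :
    (⟨0, 2 * Real.pi * k + Real.pi⟩ : ℂ) ∈ fatouTract k := by
  refine ⟨?_, ?_, ?_⟩
  · simp [Real.pi_pos]
  · simp only; linarith [Real.pi_pos]
  · rw [fatouFunction_center]; simp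

theorem isOpen_image_fatouFunction {s : Set ℂ} (hs : IsOpen s)
    (h : ∀ z ∈ s, (fatouFunction z).re < 1) : IsOpen (fatouFunction '' s) := by
  rw [isOpen_iff_mem_nhds]
  rintro _ ⟨z, hz, rfl⟩
  have hd : HasStrictDerivAt fatouFunction (1 - Complex.exp (-z)) z := by
    have := (differentiable_fatouFunction.contDiff (n := 1)).contDiffAt.hasStrictDerivAt
      (x := z) one_ne_zero
    rwa [(hasDerivAt_fatouFunction z).deriv] at this
  rw [← hd.map_nhds_eq (deriv_ne_zero_of_mem (h z hz).le)]
  exact image_mem_map (hs.mem_nhds hz)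

/-- The image is open as `f' ≠ 0`, closed relative to `x < 1` by the subsequence lemma, and
nonempty; the half-plane is connected. -/
theorem image_fatouTract (k : ℤ) : fatouFunction '' fatouTract k = {w | w.re < 1} := by
  apply Subset.antisymm
  · rintro _ ⟨z, hz, rfl⟩
    exact hz.2.2
  have ho : IsOpen (fatouFunction '' fatouTract k) :=
    isOpen_image_fatouFunction (isOpen_fatouTract k) fun z hz => hz.2.2
  refine (isPreconnected_re_lt 1).subset_of_closure_inter_subset ho
    ⟨⟨0, 2 * Real.pi * k + Real.pi⟩, by simp, _, center_mem_fatouTract k,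
      fatouFunction_center k⟩ ?_
  rintro w ⟨hw, hw1⟩
  obtain ⟨u, hu, hlim⟩ := mem_closure_iff_seq_limit.1 hw
  choose z hz hzu using hu
  obtain ⟨a, ha, hfa, -⟩ := exists_subseq_tendsto_of_mem_fatouTract (z := z) hz hw1
    (by simpa [hzu] using hlim)
  exact ⟨a, ha, hfa⟩

/-- The imaginary part equates `y - (2k+1)π` with a negative multiple of its own sine, so it
vanishes; then `x + 1 = e^{-x}` forces `x = 0`. -/
theorem fatouFunction_eq_center {k : ℤ} {z : ℂ} (hz : z ∈ fatouTract k)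
    (h : fatouFunction z = ⟨0, 2 * Real.pi * k + Real.pi⟩) :
    z = ⟨0, 2 * Real.pi * k + Real.pi⟩ := by
  have hre := congrArg Complex.re h
  have him := congrArg Complex.im h
  rw [fatouFunction_re] at hre
  rw [fatouFunction_im] at him
  simp only at hre him
  have he := Real.exp_pos (-z.re)
  obtain ⟨h1, h2, -⟩ := hz
  have hs : Real.sin z.im = -Real.sin (z.im - (2 * Real.pi * k + Real.pi)) := by
    rw [show z.im - (2 * Real.pi * k + Real.pi) = z.im - Real.pi - k * (2 * Real.pi) by ring,
      Real.sin_sub_int_mul_two_pi, Real.sin_sub_pi]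
    ring
  have hzim : z.im = 2 * Real.pi * k + Real.pi := by
    rcases lt_trichotomy (z.im - (2 * Real.pi * k + Real.pi)) 0 with h3 | h3 | h3
    · have := Real.sin_neg_of_neg_of_neg_pi_lt h3 (by linarith)
      nlinarith
    · linarith
    · have := Real.sin_pos_of_pos_of_lt_pi h3 (by linarith)
      nlinarith
  have hc : Real.cos z.im = -1 := by
    rw [hzim, show 2 * Real.pi * k + Real.pi = Real.pi + k * (2 * Real.pi) by ring,
      Real.cos_add_int_mul_two_pi, Real.cos_pi]
  rw [hc] at hre
  have hzre : z.re = 0 := by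
    rcases lt_trichotomy z.re 0 with h3 | h3 | h3
    · have := Real.add_one_lt_exp (x := -z.re) (by linarith)
      linarith
    · exact h3
    · have : Real.exp (-z.re) < 1 := Real.exp_lt_one_iff.2 (by linarith)
      linarith
  exact Complex.ext hzre hzim

/-- The set `N` of values taken twice is open and relatively closed in `x < 1`, so it is empty or
everything. The centre is taken only once. -/
theorem injOn_fatouTract (k : ℤ) : InjOn fatouFunction (fatouTract k) := by
  set N : Set ℂ := {w | ∃ a ∈ fatouTract k, ∃ b ∈ fatouTract k, a ≠ b ∧
    fatouFunction a = w ∧ fatouFunction b = w}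
  have hlocal : ∀ a ∈ fatouTract k, ∃ s ∈ 𝓝 a, InjOn fatouFunction s := by
    intro a ha
    have hd : HasStrictDerivAt fatouFunction (1 - Complex.exp (-a)) a := by
      have := (differentiable_fatouFunction.contDiff (n := 1)).contDiffAt.hasStrictDerivAt
        (x := a) one_ne_zero
      rwa [(hasDerivAt_fatouFunction a).deriv] at this
    have hd' := hd.hasStrictFDerivAt_equiv (deriv_ne_zero_of_mem ha.2.2.le)
    let e := HasStrictFDerivAt.toOpenPartialHomeomorph fatouFunction hd'
    exact ⟨e.source, e.open_source.mem_nhds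
      (HasStrictFDerivAt.mem_toOpenPartialHomeomorph_source hd'), e.injOn⟩
  have hNo : IsOpen N := by
    rw [isOpen_iff_mem_nhds]
    rintro w ⟨a, ha, b, hb, hab, rfl, hbw⟩
    obtain ⟨U, V, hU, hV, haU, hbV, hUV⟩ := t2_separation hab
    have h1 : fatouFunction '' (U ∩ fatouTract k) ∈ 𝓝 (fatouFunction a) :=
      (isOpen_image_fatouFunction (hU.inter (isOpen_fatouTract k))
        fun z hz => hz.2.2.2).mem_nhds ⟨a, ⟨haU, ha⟩, rfl⟩
    have h2 : fatouFunction '' (V ∩ fatouTract k) ∈ 𝓝 (fatouFunction a) :=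
      (isOpen_image_fatouFunction (hV.inter (isOpen_fatouTract k))
        fun z hz => hz.2.2.2).mem_nhds ⟨b, ⟨hbV, hb⟩, hbw⟩
    filter_upwards [h1, h2]
    rintro w ⟨a', ha', rfl⟩ ⟨b', hb', hb'w⟩
    exact ⟨a', ha'.2, b', hb'.2, fun h => disjoint_left.1 hUV ha'.1 (h ▸ hb'.1), rfl, hb'w⟩
  have hNc : closure N ∩ {w | w.re < 1} ⊆ N := by
    rintro w ⟨hw, hw1⟩
    obtain ⟨u, hu, hlim⟩ := mem_closure_iff_seq_limit.1 hw
    choose a ha b hb hab hau hbu using hu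
    obtain ⟨a', ha', hfa, φ, hφ, hlima⟩ := exists_subseq_tendsto_of_mem_fatouTract (z := a) ha hw1
      (by simpa [hau] using hlim)
    obtain ⟨b', hb', hfb, ψ, hψ, hlimb⟩ := exists_subseq_tendsto_of_mem_fatouTract
      (z := b ∘ φ) (fun n => hb _) hw1
      (by simpa [hbu, Function.comp_def] using hlim.comp hφ.tendsto_atTop)
    refine ⟨a', ha', b', hb', ?_, hfa, hfb⟩
    rintro rfl
    -- Two distinct preimages cannot merge in the limit, as `f` is locally injective.
    obtain ⟨s, hs, hinj⟩ := hlocal a' ha'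
    have h1 := (hlima.comp hψ.tendsto_atTop).eventually hs
    have h2 := hlimb.eventually hs
    obtain ⟨n, hn1, hn2⟩ := (h1.and h2).exists
    exact hab _ (hinj hn1 hn2 (by simp [hau, hbu]))
  have hN1 : N ⊆ {w | w.re < 1} := by
    rintro w ⟨a, ha, -, -, -, rfl, -⟩
    exact ha.2.2
  intro a ha b hb hfab
  by_contra hab
  have hsub := (isPreconnected_re_lt 1).subset_of_closure_inter_subset hNo
    ⟨fatouFunction a, ha.2.2, a, ha, b, hb, hab, rfl, hfab.symm⟩ hNc
  have hc : (⟨0, 2 * Real.pi * k + Real.pi⟩ : ℂ) ∈ N := hsub (by simp)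
  obtain ⟨a', ha', b', hb', hne, h1, h2⟩ := hc
  exact hne ((fatouFunction_eq_center ha' h1).trans (fatouFunction_eq_center hb' h2).symm)

theorem isOpenEmbedding_fatouTract (k : ℤ) :
    IsOpenEmbedding (fun z : fatouTract k => fatouFunction z) := by
  refine .of_continuous_injective_isOpenMap (by fun_prop)
    (fun a b h => Subtype.ext (injOn_fatouTract k a.2 b.2 h)) fun s hs => ?_
  have := isOpen_image_fatouFunction ((isOpen_fatouTract k).isOpenMap_subtype_val s hs) (by
    rintro _ ⟨z, -, rfl⟩; exact z.2.2.2)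
  rwa [image_image] at this

theorem image_inter_preimage_fatouTract (k : ℤ) (E : Set ℂ) :
    (fun z : fatouTract k => fatouFunction z) '' ((↑) ⁻¹' (fatouTract k ∩ fatouFunction ⁻¹' E)) =
      E ∩ {w | w.re < 1} := by
  ext w
  constructor
  · rintro ⟨z, hz, rfl⟩
    exact ⟨hz.2, z.2.2.2⟩
  · rintro ⟨hw, hw1⟩
    rw [← image_fatouTract k] at hw1
    obtain ⟨z, hz, rfl⟩ := hw1
    exact ⟨⟨z, hz⟩, ⟨hz, hw⟩, rfl⟩

theorem isSimplyConnected_fatouTract_inter {E : Set ℂ} (k : ℤ)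
    (hE : IsSimplyConnected (E ∩ {w | w.re < 1})) :
    IsSimplyConnected (fatouTract k ∩ fatouFunction ⁻¹' E) := by
  rw [← image_inter_preimage_fatouTract k E,
    (isOpenEmbedding_fatouTract k).isEmbedding.isSimplyConnected_image,
    ← (IsEmbedding.subtypeVal (p := (· ∈ fatouTract k))).isSimplyConnected_image] at hE
  rwa [Subtype.image_preimage_coe, inter_eq_right.2 inter_subset_left] at hE

theorem isPreconnected_fatouTract_inter {E : Set ℂ} (k : ℤ)
    (hE : IsPreconnected (E ∩ {w | w.re < 1})) :
    IsPreconnected (fatouTract k ∩ fatouFunction ⁻¹' E) := by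
  rw [← image_inter_preimage_fatouTract k E,
    (isOpenEmbedding_fatouTract k).isInducing.isPreconnected_image,
    ← (IsEmbedding.subtypeVal (p := (· ∈ fatouTract k))).isInducing.isPreconnected_image] at hE
  rwa [Subtype.image_preimage_coe, inter_eq_right.2 inter_subset_left] at hE

/-! ### The base: first preimage of the half-plane `x > collarLevel` -/

/-- The real part of `f(1/2 + πi)`. -/
noncomputable def collarLevel : ℝ := 3 / 2 - Real.exp (-(1 / 2))

theorem half_lt_collarLevel : 1 / 2 < collarLevel := by
  have : Real.exp (-(1 / 2)) < 1 := Real.exp_lt_one_iff.2 (by norm_num)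
  unfold collarLevel
  linarith

theorem collarLevel_lt_one : collarLevel < 1 := by
  have := Real.add_one_lt_exp (x := -(1 / 2)) (by norm_num)
  unfold collarLevel
  linarith

theorem collarLevel_lt_re_of_half_lt {z : ℂ} (h : 1 / 2 < z.re) :
    collarLevel < (fatouFunction z).re := by
  have h1 := le_re_fatouFunction z
  have h2 : Real.exp (-z.re) < Real.exp (-(1 / 2)) := Real.exp_lt_exp.2 (by linarith)
  unfold collarLevel
  linarith

/-- On these lines `Re f = x + 1 - e^{-x}` is increasing and equals `collarLevel` at `x = 1/2`. -/
theorem half_lt_re_of_cos_eq {z : ℂ} (hc : Real.cos z.im = -1)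
    (h : collarLevel < (fatouFunction z).re) : 1 / 2 < z.re := by
  by_contra! hz
  rw [fatouFunction_re, hc] at h
  have h2 : Real.exp (-(1 / 2)) ≤ Real.exp (-z.re) := Real.exp_le_exp.2 (by linarith)
  unfold collarLevel at h
  linarith

/-- The tangent of `e^{-x}/2` at `x = -log 2` gives `Re f ≥ 2 - log 2 > 1`. -/
theorem collarLevel_lt_re_of_cos {z : ℂ} (hc : 1 / 2 ≤ Real.cos z.im) :
    collarLevel < (fatouFunction z).re := by
  rw [fatouFunction_re]
  have h1 := Real.add_one_le_exp (-z.re - Real.log 2)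
  rw [Real.exp_sub, Real.exp_log two_pos] at h1
  have h2 := Real.log_two_lt_d9
  have h3 := collarLevel_lt_one
  nlinarith [Real.exp_pos (-z.re)]

/-- The part of a half-strip that `f` maps into the half-plane `x > collarLevel`. -/
def fatouBase (M : ℝ) (K : ℕ) : Set ℂ :=
  {z | -M < z.re ∧ |z.im| < 2 * Real.pi * K ∧ collarLevel < (fatouFunction z).re}

theorem isOpen_fatouBase (M : ℝ) (K : ℕ) : IsOpen (fatouBase M K) :=
  (isOpen_lt continuous_const Complex.continuous_re).inter
    ((isOpen_lt Complex.continuous_im.abs continuous_const).inter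
      (isOpen_lt continuous_const (Complex.continuous_re.comp continuous_fatouFunction)))

theorem fatouBase_mono {M M' : ℝ} {K K' : ℕ} (hM : M ≤ M') (hK : K ≤ K') :
    fatouBase M K ⊆ fatouBase M' K' := by
  rintro z ⟨h1, h2, h3⟩
  refine ⟨by linarith, h2.trans_le ?_, h3⟩
  gcongr

theorem min_cos_le_cos_of_abs_le {θ θ₁ θ₂ : ℝ} (h₁ : |θ₁| ≤ Real.pi) (h₂ : |θ₂| ≤ Real.pi)
    (h : |θ| ≤ max |θ₁| |θ₂|) : min (Real.cos θ₁) (Real.cos θ₂) ≤ Real.cos θ := by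
  rw [← Real.cos_abs θ, ← Real.cos_abs θ₁, ← Real.cos_abs θ₂]
  rcases le_max_iff.1 h with h | h
  · exact (min_le_left _ _).trans (Real.cos_le_cos_of_nonneg_of_le_pi (abs_nonneg _) h₁ h)
  · exact (min_le_right _ _).trans (Real.cos_le_cos_of_nonneg_of_le_pi (abs_nonneg _) h₂ h)

theorem convex_reProdIm {s t : Set ℝ} (hs : Convex ℝ s) (ht : Convex ℝ t) :
    Convex ℝ (s ×ℂ t) :=
  (hs.is_linear_preimage Complex.reLm.isLinear).inter
    (ht.is_linear_preimage Complex.imLm.isLinear)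

/-- For fixed `x` the condition bounds `cos y` from below, and `cos` decreases with the distance
from `2πk`. Vertical segments to the line `y = η`, where `cos η = 1/2`, therefore stay inside. The
line `y = 2πk` would not serve for `k = ±K`: it is outside the open strip. -/
theorem isSimplyConnected_fatouBase_piece {M : ℝ} {K : ℕ} (hM : 0 ≤ M) {k : ℤ} {η : ℝ}
    (hη : |η| < 2 * Real.pi * K) (hηk : |η - 2 * Real.pi * k| = Real.pi / 3) :
    IsSimplyConnected (fatouBase M K ∩ {z | z.re < 1 ∧ |z.im - 2 * Real.pi * k| < Real.pi}) := by
  have hcos : ∀ y : ℝ, Real.cos (y - 2 * Real.pi * k) = Real.cos y := fun y => by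
    rw [show 2 * Real.pi * (k : ℝ) = k * (2 * Real.pi) by ring, Real.cos_sub_int_mul_two_pi]
  have hcosη : Real.cos η = 1 / 2 := by
    rw [← hcos, ← Real.cos_abs, hηk, Real.cos_pi_div_three]
  have hpi := Real.pi_pos
  have hls : Ioo (-M) 1 ×ℂ {η} ⊆
      fatouBase M K ∩ {z | z.re < 1 ∧ |z.im - 2 * Real.pi * k| < Real.pi} := by
    rintro z ⟨hz1, hz2 : z.im = η⟩
    exact ⟨⟨hz1.1, by rw [hz2]; exact hη, collarLevel_lt_re_of_cos (by rw [hz2, hcosη])⟩,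
      hz1.2, by rw [hz2, hηk]; linarith⟩
  refine IsSimplyConnected.of_segment_retraction (r := fun z => ⟨z.re, η⟩)
    (l := Ioo (-M) 1 ×ℂ {η}) ?_ (convex_reProdIm (convex_Ioo _ _) (convex_singleton _)) hls
    ⟨⟨1 / 2, η⟩, hls ⟨⟨by simp only; linarith, by norm_num⟩, rfl⟩⟩ ?_ ?_
  · have : (fun z : ℂ => (⟨z.re, η⟩ : ℂ)) = fun z => (z.re : ℂ) + η * Complex.I := by
      ext z
      exact Complex.mk_eq_add_mul_I _ _
    rw [this]
    fun_prop
  · rintro z ⟨hz1, hz2⟩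
    exact ⟨⟨hz1.1, hz2.1⟩, rfl⟩
  · rintro z ⟨⟨hz1, hz2, hz3⟩, hz4, hz5⟩ w ⟨a, b, ha, hb, hab, rfl⟩
    set w := a • z + b • (⟨z.re, η⟩ : ℂ)
    have hre : w.re = z.re := by
      simp only [w, Complex.add_re, Complex.real_smul, Complex.mul_re, Complex.ofReal_re,
        Complex.ofReal_im, zero_mul, sub_zero]
      rw [← add_mul, hab, one_mul]
    have him : w.im = a * z.im + b * η := by
      simp [w]
    have hmax : ∀ c : ℝ, |w.im - c| ≤ max |z.im - c| |η - c| := by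
      intro c
      have : w.im - c = a * (z.im - c) + b * (η - c) := by
        rw [him]; linear_combination c * hab
      rw [this]
      calc |a * (z.im - c) + b * (η - c)| ≤ a * |z.im - c| + b * |η - c| := by
            refine (abs_add_le _ _).trans_eq ?_
            rw [abs_mul, abs_mul, abs_of_nonneg ha, abs_of_nonneg hb]
        _ ≤ a * max |z.im - c| |η - c| + b * max |z.im - c| |η - c| := by
            gcongr
            · exact le_max_left _ _
            · exact le_max_right _ _
        _ = _ := by rw [← add_mul, hab, one_mul]
    have h0 := hmax 0
    simp only [sub_zero] at h0
    have hmin := min_cos_le_cos_of_abs_le hz5.le (by rw [hηk]; linarith)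
      (hmax (2 * Real.pi * k))
    rw [hcos, hcos, hcos] at hmin
    refine ⟨⟨by rw [hre]; exact hz1, h0.trans_lt (max_lt hz2 hη), ?_⟩, by rw [hre]; exact hz4,
      (hmax _).trans_lt (max_lt hz5 (by rw [hηk]; linarith))⟩
    rcases min_le_iff.1 hmin with h | h
    · refine hz3.trans_le ?_
      rw [fatouFunction_re, fatouFunction_re, hre]
      gcongr
    · exact collarLevel_lt_re_of_cos (by rwa [hcosη] at h)

theorem isOpen_reProdIm_Ioo (a b c d : ℝ) : IsOpen (Ioo a b ×ℂ Ioo c d) :=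
  isOpen_Ioo.reProdIm isOpen_Ioo

theorem isSimplyConnected_fatouBase {M : ℝ} {K : ℕ} (hM : 0 ≤ M) (hK : 1 ≤ K) :
    IsSimplyConnected (fatouBase M K ∩ {z | z.re < 1}) := by
  have hpi := Real.pi_pos
  have hK' : (1 : ℝ) ≤ K := by exact_mod_cast hK
  set A : Set ℂ := Ioo (1 / 2) 1 ×ℂ Ioo (-(2 * Real.pi * K)) (2 * Real.pi * K)
  set B : ℤ → Set ℂ := fun k =>
    fatouBase M K ∩ {z | z.re < 1 ∧ |z.im - 2 * Real.pi * k| < Real.pi}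
  have hAsub : A ⊆ fatouBase M K ∩ {z | z.re < 1} := by
    rintro z ⟨hz1, hz2⟩
    exact ⟨⟨by linarith [hz1.1], abs_lt.2 hz2, collarLevel_lt_re_of_half_lt hz1.1⟩, hz1.2⟩
  have hη : ∀ k ∈ Finset.Icc (-(K : ℤ)) K, ∃ η : ℝ, |η| < 2 * Real.pi * K ∧
      |η - 2 * Real.pi * k| = Real.pi / 3 := by
    intro k hk
    obtain ⟨hk1, hk2⟩ := Finset.mem_Icc.1 hk
    have hk1' : -(K : ℝ) ≤ k := by exact_mod_cast hk1
    -- The line is shifted up, except at the top `k = K`, where it is shifted down to stay in the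
    -- strip.
    rcases lt_or_eq_of_le hk2 with h | h
    · have h' : (k : ℝ) + 1 ≤ K := by exact_mod_cast h
      refine ⟨2 * Real.pi * k + Real.pi / 3, ?_, ?_⟩
      · rw [abs_lt]
        constructor <;> nlinarith
      · rw [add_sub_cancel_left, abs_of_pos (by positivity)]
    · have h' : (k : ℝ) = K := by exact_mod_cast h
      refine ⟨2 * Real.pi * k - Real.pi / 3, ?_, ?_⟩
      · rw [abs_lt, h']
        constructor <;> nlinarith
      · rw [sub_sub_cancel_left, abs_neg, abs_of_pos (by positivity)]
  have hunion : fatouBase M K ∩ {z | z.re < 1} = A ∪ ⋃ k ∈ Finset.Icc (-(K : ℤ)) K, B k := by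
    apply Subset.antisymm
    · rintro z ⟨hz, hz1⟩
      set k := round (z.im / (2 * Real.pi))
      have hround : |z.im - 2 * Real.pi * k| ≤ Real.pi := by
        have h1 := abs_sub_round (z.im / (2 * Real.pi))
        have h2 : z.im - 2 * Real.pi * k = 2 * Real.pi * (z.im / (2 * Real.pi) - k) := by
          field_simp
        rw [h2, abs_mul, abs_of_pos (by positivity)]
        nlinarith
      rcases lt_or_eq_of_le hround with h | h
      · right
        refine mem_biUnion (x := k) ?_ ⟨hz, hz1, h⟩
        obtain ⟨h1, h2⟩ := abs_lt.1 h
        obtain ⟨h3, h4⟩ := abs_lt.1 hz.2.1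
        have h5 : (k : ℝ) < K + 1 := by
          by_contra! hh
          nlinarith
        have h6 : -(K : ℝ) < k + 1 := by
          by_contra! hh
          nlinarith
        rw [Finset.coe_Icc, mem_Icc]
        norm_cast at h5
        have h6 : -(K : ℤ) < k + 1 := by exact_mod_cast h6
        omega
      -- Midway between pieces `cos y = -1`, so the point lies in the slab `A`.
      · left
        have hc : Real.cos z.im = -1 := by
          have : Real.cos (z.im - 2 * Real.pi * k) = -1 := by
            rw [← Real.cos_abs, h, Real.cos_pi]
          rwa [show 2 * Real.pi * (k : ℝ) = k * (2 * Real.pi) by ring,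
            Real.cos_sub_int_mul_two_pi] at this
        exact ⟨⟨half_lt_re_of_cos_eq hc hz.2.2, hz1⟩, abs_lt.1 hz.2.1⟩
    · refine union_subset hAsub (iUnion₂_subset fun k _ => ?_)
      rintro z ⟨hz1, hz2, -⟩
      exact ⟨hz1, hz2⟩
  rw [hunion]
  refine IsSimplyConnected.union_biUnion ?_ (isOpen_reProdIm_Ioo _ _ _ _) _ ?_ ?_ ?_ ?_
  · refine (convex_reProdIm (convex_Ioo _ _) (convex_Ioo _ _)).isSimplyConnected ⟨⟨3 / 4, 0⟩, ?_, ?_⟩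
    · constructor <;> norm_num
    · constructor <;> simp only <;> nlinarith
  · intro k hk
    obtain ⟨η, h1, h2⟩ := hη k hk
    exact isSimplyConnected_fatouBase_piece hM h1 h2
  · intro k _
    exact (isOpen_fatouBase M K).inter ((isOpen_lt Complex.continuous_re continuous_const).inter
      (isOpen_lt (Complex.continuous_im.sub continuous_const).abs continuous_const))
  · intro k hk
    obtain ⟨η, h1, h2⟩ := hη k hk
    have hAB : A ∩ B k = A ∩ (univ ×ℂ Ioo (2 * Real.pi * k - Real.pi)
        (2 * Real.pi * k + Real.pi)) := by
      ext z
      have hiff : |z.im - 2 * Real.pi * k| < Real.pi ↔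
          z.im ∈ Ioo (2 * Real.pi * k - Real.pi) (2 * Real.pi * k + Real.pi) := by
        rw [abs_lt, mem_Ioo]
        constructor <;> rintro ⟨h, h'⟩ <;> constructor <;> linarith
      constructor
      · rintro ⟨hA, -, -, h⟩
        exact ⟨hA, trivial, hiff.1 h⟩
      · rintro ⟨hA, -, h⟩
        exact ⟨hA, (hAsub hA).1, (hAsub hA).2, hiff.2 h⟩
    have hpos : |η - 2 * Real.pi * k| < Real.pi := by rw [h2]; linarith
    rw [hAB]
    refine Convex.isPathConnected ?_ ⟨⟨3 / 4, η⟩, ⟨?_, abs_lt.1 h1⟩, trivial, ?_⟩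
    · exact (convex_reProdIm (convex_Ioo _ _) (convex_Ioo _ _)).inter
        (convex_reProdIm convex_univ (convex_Ioo _ _))
    · constructor <;> norm_num
    · rw [abs_lt] at hpos
      constructor <;> simp only <;> linarith
  · rintro j - k - hjk z ⟨⟨-, -, hj⟩, ⟨-, -, hk⟩⟩
    exfalso
    apply hjk
    rw [abs_lt] at hj hk
    have h1 : (j : ℝ) < k + 1 := by
      by_contra! hh
      nlinarith
    have h2 : (k : ℝ) < j + 1 := by
      by_contra! hh
      nlinarith
    norm_cast at h1 h2
    omega

/-! ### Connectedness of the escaping set -/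

/-- The points whose `n`-th iterate lies in the half-plane `x > collarLevel`. -/
def fatouEscape (n : ℕ) : Set ℂ := {z | collarLevel < (fatouFunction^[n] z).re}

theorem fatouEscape_mono : Monotone fatouEscape := by
  refine monotone_nat_of_le_succ fun n z hz => ?_
  unfold fatouEscape at hz ⊢
  rw [mem_ofPred_eq, Function.iterate_succ_apply']
  have h0 : 0 < collarLevel := by linarith [half_lt_collarLevel]
  exact lt_of_lt_of_le hz (le_re_of_nonneg (h0.trans hz).le)

theorem fatouEscape_subset (n : ℕ) : fatouEscape n ⊆ escapingSet fatouFunction := by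
  intro z hz
  rw [← mem_escapingSet_iterate_iff n]
  have h0 : 0 < collarLevel := by linarith [half_lt_collarLevel]
  exact mem_escapingSet_of_re_pos (h0.trans hz)

theorem isPreconnected_fatouEscape_one :
    IsPreconnected (fatouEscape 1 ∩ {z | z.re < 1}) := by
  have h : fatouEscape 1 ∩ {z | z.re < 1} =
      ⋃ n : ℕ, fatouBase n (n + 1) ∩ {z | z.re < 1} := by
    ext z
    simp only [mem_iUnion]
    constructor
    · rintro ⟨h1, h2⟩
      obtain ⟨n, hn⟩ := exists_nat_gt (max (-z.re) |z.im|)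
      obtain ⟨h3, h4⟩ := max_lt_iff.1 hn
      refine ⟨n, ⟨by linarith, ?_, h1⟩, h2⟩
      push_cast
      nlinarith [Real.pi_gt_three]
    · rintro ⟨n, h1, h2⟩
      exact ⟨h1.2.2, h2⟩
  rw [h]
  refine (IsSimplyConnected.iUnion_of_monotone
    (fun n => isSimplyConnected_fatouBase (Nat.cast_nonneg n) (Nat.le_add_left 1 n))
    (fun n => (isOpen_fatouBase _ _).inter (isOpen_lt Complex.continuous_re continuous_const))
    ?_).isPathConnected.isConnected.isPreconnected
  intro m n hmn
  exact inter_subset_inter_left _ (fatouBase_mono (by exact_mod_cast hmn) (by omega))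

/-- A point outside `V` lies in some tract, whose pullback of `fatouEscape n` is connected and meets
`V` over the collar `collarLevel < x < 1`. -/
theorem isPreconnected_fatouEscape_inter (n : ℕ) :
    IsPreconnected (fatouEscape n ∩ {z | z.re < 1}) := by
  induction n with
  | zero =>
    have h : fatouEscape 0 ∩ {z | z.re < 1} = Ioo collarLevel 1 ×ℂ univ := by
      ext z
      simp [fatouEscape, Complex.mem_reProdIm]
    rw [h]
    exact (convex_reProdIm (convex_Ioo _ _) convex_univ).isPreconnected
  | succ n ih =>
    have h1 := fatouEscape_mono (Nat.le_add_left 1 n)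
    set V := fatouEscape 1 ∩ {z : ℂ | z.re < 1}
    have hmem : ∀ k, ∃ z ∈ fatouTract k, z ∈ V := by
      intro k
      have hw : (⟨(collarLevel + 1) / 2, 0⟩ : ℂ) ∈ {w : ℂ | w.re < 1} := by
        have := collarLevel_lt_one
        simp only [mem_ofPred_eq]
        linarith
      rw [← image_fatouTract k] at hw
      obtain ⟨z, hz, hzw⟩ := hw
      refine ⟨z, hz, ?_, re_lt_of_re_lt zero_le_one hz.2.2⟩
      have := collarLevel_lt_one
      have h2 : collarLevel < (fatouFunction z).re := by rw [hzw]; simp only; linarith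
      exact h2
    obtain ⟨x, -, hx⟩ := hmem 0
    refine isPreconnected_of_forall x fun y hy => ?_
    by_cases hyV : y ∈ V
    · exact ⟨V, inter_subset_inter_left _ h1, hx, hyV, isPreconnected_fatouEscape_one⟩
    · have hy1 : (fatouFunction y).re < 1 := by
        by_contra! hh
        exact hyV ⟨collarLevel_lt_one.trans_le hh, hy.2⟩
      obtain ⟨k, hk⟩ := exists_mem_fatouTract hy1
      refine ⟨V ∪ (fatouTract k ∩ fatouFunction ⁻¹' fatouEscape n), ?_, Or.inl hx,
        Or.inr ⟨hk, hy.1⟩, ?_⟩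
      · refine union_subset (inter_subset_inter_left _ h1) ?_
        rintro z ⟨hz1, hz2⟩
        exact ⟨hz2, re_lt_of_re_lt zero_le_one hz1.2.2⟩
      · obtain ⟨u, hu, huV⟩ := hmem k
        exact isPreconnected_fatouEscape_one.union u huV ⟨hu, h1 huV.1⟩
          (isPreconnected_fatouTract_inter k ih)

theorem isPreconnected_iUnion_fatouEscape : IsPreconnected (⋃ n, fatouEscape n) := by
  have hhalf : IsPreconnected {z : ℂ | collarLevel < z.re} :=
    (convex_halfSpace_re_gt _).isPreconnected
  have hsub : ∀ n, {z : ℂ | collarLevel < z.re} ⊆ fatouEscape n :=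
    fun n => fatouEscape_mono (Nat.zero_le n)
  have hpt : ∀ n, (⟨(collarLevel + 1) / 2, 0⟩ : ℂ) ∈ fatouEscape n := fun n => hsub n (by
    have := collarLevel_lt_one
    simp only [mem_ofPred_eq]
    linarith)
  refine isPreconnected_iUnion ⟨⟨(collarLevel + 1) / 2, 0⟩, mem_iInter.2 hpt⟩ fun n => ?_
  have h : fatouEscape n = (fatouEscape n ∩ {z | z.re < 1}) ∪ {z : ℂ | collarLevel < z.re} := by
    apply Subset.antisymm
    · intro z hz
      rcases lt_or_ge z.re 1 with h | h
      · exact Or.inl ⟨hz, h⟩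
      · exact Or.inr (collarLevel_lt_one.trans_le h)
    · exact union_subset inter_subset_left (hsub n)
  have := collarLevel_lt_one
  rw [h]
  refine (isPreconnected_fatouEscape_inter n).union ⟨(collarLevel + 1) / 2, 0⟩ ⟨hpt n, ?_⟩ ?_ hhalf
  · simp only [mem_ofPred_eq]; linarith
  · simp only [mem_ofPred_eq]; linarith

theorem exists_hasDerivAt_iterate {z : ℂ} (h : ∀ n, (fatouFunction^[n] z).re ≤ 1) (n : ℕ) :
    ∃ d, HasDerivAt (fatouFunction^[n]) d z ∧ (2 : ℝ) ^ n ≤ ‖d‖ ^ 2 := by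
  induction n with
  | zero => exact ⟨1, hasDerivAt_id z, by simp⟩
  | succ n ih =>
    obtain ⟨d, hd, hdn⟩ := ih
    refine ⟨_, Function.iterate_succ' fatouFunction n ▸
      (hasDerivAt_fatouFunction (fatouFunction^[n] z)).comp z hd, ?_⟩
    have h1 := two_le_normSq_deriv (z := fatouFunction^[n] z) (by
      rw [← Function.iterate_succ_apply' fatouFunction]
      exact h (n + 1))
    rw [norm_mul, mul_pow, pow_succ, mul_comm]
    exact mul_le_mul h1 hdn (by positivity) (by positivity)

theorem dense_iUnion_fatouEscape : Dense (⋃ n, fatouEscape n) := by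
  rw [Metric.dense_iff]
  intro z r hr
  by_contra hne
  rw [not_nonempty_iff_eq_empty] at hne
  have hall : ∀ w ∈ ball z r, ∀ n, (fatouFunction^[n] w).re < 1 := by
    intro w hw n
    by_contra! hh
    have : w ∈ ball z r ∩ ⋃ n, fatouEscape n :=
      ⟨hw, mem_iUnion.2 ⟨n, collarLevel_lt_one.trans_le hh⟩⟩
    rwa [hne] at this
  have hrho : 0 < r / 2 := by linarith
  have hsub : closedBall z (r / 2) ⊆ ball z r := closedBall_subset_ball (by linarith)
  have hz : z ∈ closedBall z (r / 2) := mem_closedBall_self hrho.le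
  have hcont : ∀ n, Continuous (fatouFunction^[n]) := fun n => continuous_fatouFunction.iterate n
  have hbound : ∀ n : ℕ, (2 : ℝ) ^ n ≤ (Real.exp (2 * Real.pi) / (r / 2)) ^ 2 := by
    intro n
    have hre : ∀ w ∈ closedBall z (r / 2), (fatouFunction (fatouFunction^[n] w)).re < 1 := by
      intro w hw
      rw [← Function.iterate_succ_apply' fatouFunction]
      exact hall w (hsub hw) (n + 1)
    obtain ⟨k, hk1, hk2, -⟩ := exists_mem_fatouTract (hre z hz)
    have hstrip : ∀ w ∈ closedBall z (r / 2), 2 * Real.pi * k < (fatouFunction^[n] w).im ∧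
        (fatouFunction^[n] w).im < 2 * Real.pi * (k + 1) := by
      -- The image of the disc is connected and avoids the lines `y = 2πj`, so it stays in one
      -- strip.
      have hpre : IsPreconnected ((fun w => (fatouFunction^[n] w).im) '' closedBall z (r / 2)) :=
        (convex_closedBall z (r / 2)).isPreconnected.image _
          (Complex.continuous_im.comp (hcont n)).continuousOn
      have hoc := hpre.ordConnected
      intro w hw
      constructor
      · by_contra! hh
        obtain ⟨u, hu, hu'⟩ := hoc.out (mem_image_of_mem _ hw) (mem_image_of_mem _ hz) ⟨hh, hk1.le⟩
        exact im_ne_of_re_lt_one (hre u hu) k hu'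
      · by_contra! hh
        obtain ⟨u, hu, hu'⟩ := hoc.out (mem_image_of_mem _ hz) (mem_image_of_mem _ hw) ⟨hk2.le, hh⟩
        exact im_ne_of_re_lt_one (hre u hu) (k + 1) (by push_cast; exact hu')
    obtain ⟨d, hd, hdn⟩ := exists_hasDerivAt_iterate (fun m => (hall z (hsub hz) m).le) n
    -- `|Φ|` depends only on the imaginary part of the iterate: it is at most `e^{2π}` on the disc
    -- and at least 1 at `z`, so Cauchy's estimate for `Φ` bounds `d`.
    set Φ : ℂ → ℂ := fun w =>
      Complex.exp (-Complex.I * fatouFunction^[n] w - ((2 * Real.pi * k : ℝ) : ℂ))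
    have hΦnorm : ∀ w, ‖Φ w‖ = Real.exp ((fatouFunction^[n] w).im - 2 * Real.pi * k) := by
      intro w
      simp only [Φ, Complex.norm_exp]
      congr 1
      simp only [Complex.sub_re, Complex.neg_re, Complex.neg_im, Complex.mul_re, Complex.I_re,
        Complex.I_im, Complex.ofReal_re]
      ring
    have hΦd : HasDerivAt Φ (Φ z * (-Complex.I * d)) z :=
      ((hd.const_mul (-Complex.I)).sub_const _).cexp
    have hΦdiff : Differentiable ℂ Φ := by
      have : Differentiable ℂ (fatouFunction^[n]) := differentiable_fatouFunction.iterate n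
      fun_prop
    have hC := Complex.norm_deriv_le_of_forall_mem_sphere_norm_le hrho
      (hΦdiff.diffContOnCl (s := ball z (r / 2))) (C := Real.exp (2 * Real.pi)) (by
        intro w hw
        rw [hΦnorm]
        have := (hstrip w (sphere_subset_closedBall hw)).2
        exact Real.exp_le_exp.2 (by linarith))
    rw [hΦd.deriv, norm_mul, norm_mul, norm_neg, Complex.norm_I, one_mul, hΦnorm] at hC
    have h1 : 1 ≤ Real.exp ((fatouFunction^[n] z).im - 2 * Real.pi * k) :=
      Real.one_le_exp (by linarith)
    have h2 : ‖d‖ ≤ Real.exp (2 * Real.pi) / (r / 2) := by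
      refine le_trans ?_ hC
      exact le_mul_of_one_le_left (norm_nonneg _) h1
    exact hdn.trans (pow_le_pow_left₀ (norm_nonneg _) h2 2)
  obtain ⟨n, hn⟩ := pow_unbounded_of_one_lt ((Real.exp (2 * Real.pi) / (r / 2)) ^ 2) one_lt_two
  exact absurd (hbound n) (not_le.2 hn)

theorem isConnected_escapingSet_fatouFunction : IsConnected (escapingSet fatouFunction) := by
  refine ⟨⟨1, mem_escapingSet_of_re_pos (by simp)⟩,
    isPreconnected_iUnion_fatouEscape.subset_closure (iUnion_subset fatouEscape_subset) ?_⟩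
  rw [dense_iUnion_fatouEscape.closure_eq]
  exact subset_univ _

/-! ### Approximating domains -/

/-- Rapidly growing sizes with `fatouSize (n + 1) ≈ exp (fatouSize n)`. -/
noncomputable def fatouSize : ℕ → ℕ
  | 0 => 1
  | n + 1 => ⌈(fatouSize n : ℝ) + Real.exp (fatouSize n)⌉₊

theorem add_exp_le_fatouSize_succ (n : ℕ) :
    (fatouSize n : ℝ) + Real.exp (fatouSize n) ≤ fatouSize (n + 1) :=
  Nat.le_ceil _

theorem fatouSize_succ_lt (n : ℕ) :
    (fatouSize (n + 1) : ℝ) < fatouSize n + Real.exp (fatouSize n) + 1 :=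
  Nat.ceil_lt_add_one (by positivity)

theorem fatouSize_lt_succ (n : ℕ) : fatouSize n < fatouSize (n + 1) := by
  have h := add_exp_le_fatouSize_succ n
  have := Real.exp_pos (fatouSize n)
  exact_mod_cast (by linarith : (fatouSize n : ℝ) < fatouSize (n + 1))

theorem lt_fatouSize (n : ℕ) : n < fatouSize n := by
  induction n with
  | zero => simp [fatouSize]
  | succ n ih =>
    have := fatouSize_lt_succ n
    omega

theorem one_le_fatouSize (n : ℕ) : 1 ≤ fatouSize n := by
  have := lt_fatouSize n
  omega

/-- The margin 5 supplies a factor `e^5 ≥ 100`, which absorbs all the constants multiplying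
`e^{fatouSize n}`. -/
theorem fatouSize_growth (n : ℕ) :
    (fatouSize (n + 1) + 5) + 2 * Real.pi * fatouSize (n + 1) + 2 * Real.pi * fatouSize n + 3 <
      Real.exp (fatouSize n + 5) - (fatouSize n + 5) := by
  have h1 := fatouSize_succ_lt n
  have h2 := Real.add_one_le_exp (fatouSize n : ℝ)
  have h3 : (100 : ℝ) ≤ Real.exp 5 := by
    have h := Real.exp_one_gt_d9
    rw [show (5 : ℝ) = (5 : ℕ) * 1 by norm_num, Real.exp_nat_mul]
    have : (2.7 : ℝ) ^ 5 ≤ Real.exp 1 ^ 5 := pow_le_pow_left₀ (by norm_num) (by linarith) 5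
    norm_num at this ⊢
    linarith
  have h4 := Real.pi_lt_d2
  have h5 : (0 : ℝ) ≤ fatouSize n := Nat.cast_nonneg _
  have h6 : (0 : ℝ) ≤ fatouSize (n + 1) := Nat.cast_nonneg _
  rw [Real.exp_add]
  have h7 : Real.exp (fatouSize n) * 100 ≤ Real.exp (fatouSize n) * Real.exp 5 := by gcongr
  have h8 : 2 * Real.pi * fatouSize (n + 1) ≤ 6.3 * fatouSize (n + 1) := by
    gcongr; linarith
  have h9 : 2 * Real.pi * fatouSize n ≤ 6.3 * fatouSize n := by
    gcongr; linarith
  linarith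

theorem abs_im_lt_of_mem_fatouTract {z : ℂ} {k : ℤ} {K : ℕ} (hz : z ∈ fatouTract k)
    (hk : k ∈ Finset.Ico (-(K : ℤ)) K) : |z.im| < 2 * Real.pi * K := by
  have hpi := Real.pi_pos
  obtain ⟨h1, h2⟩ := Finset.mem_Ico.1 hk
  have h1' : -(K : ℝ) ≤ k := by exact_mod_cast h1
  have h2' : (k : ℝ) + 1 ≤ K := by exact_mod_cast h2
  obtain ⟨h3, h4, -⟩ := hz
  rw [abs_lt]
  constructor <;> nlinarith

/-- Further left, `e^{-x}` would exceed what `exp_neg_re_le` allows. This keeps the left bound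
`fatouSize n + 5` uniform over all depths `m`. -/
theorem re_gt_of_mem_fatouTract {z : ℂ} {k : ℤ} {n : ℕ} (hz : z ∈ fatouTract k)
    (hk : k ∈ Finset.Ico (-(fatouSize n : ℤ)) (fatouSize n))
    (hre : -((fatouSize (n + 1) : ℝ) + 5) < (fatouFunction z).re)
    (him : |(fatouFunction z).im| < 2 * Real.pi * fatouSize (n + 1)) :
    -((fatouSize n : ℝ) + 5) < z.re := by
  by_contra! hh
  have h1 := abs_im_lt_of_mem_fatouTract hz hk
  have h2 := exp_neg_re_le z
  have h3 := fatouSize_growth n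
  have h4 : |(fatouFunction z).re| ≤ fatouSize (n + 1) + 5 := by
    have := hz.2.2
    have : (0 : ℝ) ≤ fatouSize (n + 1) := Nat.cast_nonneg _
    rw [abs_le]
    constructor <;> linarith
  have h5 : (0 : ℝ) ≤ fatouSize n := Nat.cast_nonneg _
  rw [abs_of_neg (show z.re < 0 by linarith)] at h2
  -- `e^t - t` increases for `t ≥ 0`; here `t = -x` is compared with `fatouSize n + 5`.
  have h6 : Real.exp (fatouSize n + 5) + (-z.re - (fatouSize n + 5)) ≤ Real.exp (-z.re) := by
    have h7 : Real.exp (-z.re) =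
        Real.exp (fatouSize n + 5) * Real.exp (-z.re - (fatouSize n + 5)) := by
      rw [← Real.exp_add]; congr 1; ring
    have h8 := Real.add_one_le_exp (-z.re - (fatouSize n + 5))
    have h9 : 1 ≤ Real.exp (fatouSize n + 5) := Real.one_le_exp (by linarith)
    rw [h7]
    nlinarith
  linarith

/-- Finite approximations of the domains bounded by loops of the spider's web. At each step a
truncated half-strip `fatouBase` is enlarged by the pullbacks of the previous approximation to
finitely many tracts. -/
def fatouWeb : ℕ → ℕ → Set ℂ
  | 0, n => {z | -(fatouSize n : ℝ) < z.re ∧ |z.im| < 2 * Real.pi * fatouSize n}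
  | m + 1, n => fatouBase (fatouSize n + 5) (fatouSize n) ∪
      ⋃ k ∈ Finset.Ico (-(fatouSize n : ℤ)) (fatouSize n),
        fatouTract k ∩ fatouFunction ⁻¹' fatouWeb m (n + 1)

theorem mem_fatouWeb_succ {m n : ℕ} {z : ℂ} : z ∈ fatouWeb (m + 1) n ↔
    z ∈ fatouBase (fatouSize n + 5) (fatouSize n) ∨
      ∃ k ∈ Finset.Ico (-(fatouSize n : ℤ)) (fatouSize n),
        z ∈ fatouTract k ∧ fatouFunction z ∈ fatouWeb m (n + 1) := by
  simp only [fatouWeb, mem_union, mem_iUnion, mem_inter_iff, mem_preimage, exists_prop]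

theorem isOpen_fatouWeb (m n : ℕ) : IsOpen (fatouWeb m n) := by
  induction m generalizing n with
  | zero =>
    exact (isOpen_lt continuous_const Complex.continuous_re).inter
      (isOpen_lt Complex.continuous_im.abs continuous_const)
  | succ m ih =>
    exact (isOpen_fatouBase _ _).union (isOpen_biUnion fun k _ =>
      (isOpen_fatouTract k).inter ((ih (n + 1)).preimage continuous_fatouFunction))

theorem fatouWeb_bounds {m n : ℕ} {z : ℂ} (hz : z ∈ fatouWeb m n) :
    -((fatouSize n : ℝ) + 5) < z.re ∧ |z.im| < 2 * Real.pi * fatouSize n := by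
  induction m generalizing n z with
  | zero => exact ⟨by linarith [hz.1], hz.2⟩
  | succ m ih =>
    rcases mem_fatouWeb_succ.1 hz with h | ⟨k, hk, h1, h2⟩
    · exact ⟨h.1, h.2.1⟩
    · obtain ⟨h3, h4⟩ := ih h2
      exact ⟨re_gt_of_mem_fatouTract h1 hk h3 h4, abs_im_lt_of_mem_fatouTract h1 hk⟩

theorem mem_fatouWeb_of_half_lt {z : ℂ} (m : ℕ) {n : ℕ} (h : 1 / 2 < z.re)
    (him : |z.im| < 2 * Real.pi * fatouSize n) : z ∈ fatouWeb m n := by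
  have : (0 : ℝ) ≤ fatouSize n := Nat.cast_nonneg _
  cases m with
  | zero => exact ⟨by linarith, him⟩
  | succ m =>
    exact mem_fatouWeb_succ.2
      (Or.inl ⟨by linarith, him, collarLevel_lt_re_of_half_lt h⟩)

theorem exists_mem_fatouTract_of_abs_im_le {z : ℂ} {K : ℕ} (h : (fatouFunction z).re < 1)
    (him : |z.im| ≤ 2 * Real.pi * K) :
    ∃ k ∈ Finset.Ico (-(K : ℤ)) K, z ∈ fatouTract k := by
  obtain ⟨k, hk⟩ := exists_mem_fatouTract h
  refine ⟨k, ?_, hk⟩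
  obtain ⟨h1, h2, -⟩ := hk
  obtain ⟨h3, h4⟩ := abs_le.1 him
  have hpi : 0 < 2 * Real.pi := by positivity
  have h5 : (k : ℝ) < K := lt_of_mul_lt_mul_left (h1.trans_le h4) hpi.le
  have h6 : -(K : ℝ) < k + 1 := lt_of_mul_lt_mul_left (by linarith) hpi.le
  have h5 : k < (K : ℤ) := by exact_mod_cast h5
  have h6 : -(K : ℤ) < k + 1 := by exact_mod_cast h6
  rw [Finset.mem_Ico]
  omega

/-- On the half-strip at level `n`, `f` moves points left or vertically by less than `e^{fatouSize
n}`, hence into the half-strip at level `n + 1`. Deeper inclusions follow by pullback. -/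
theorem fatouWeb_mono_left (n : ℕ) : Monotone fun m => fatouWeb m n := by
  refine monotone_nat_of_le_succ fun m => ?_
  induction m generalizing n with
  | zero =>
    rintro z ⟨h1, h2⟩
    refine mem_fatouWeb_succ.2 ?_
    rcases lt_or_ge collarLevel (fatouFunction z).re with h | h
    · exact Or.inl ⟨by linarith, h2, h⟩
    · obtain ⟨k, hk, hzk⟩ := exists_mem_fatouTract_of_abs_im_le (h.trans_lt collarLevel_lt_one) h2.le
      refine Or.inr ⟨k, hk, hzk, ?_⟩
      have h3 : Real.exp (-z.re) < Real.exp (fatouSize n) := Real.exp_lt_exp.2 (by linarith)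
      have h4 := le_re_fatouFunction z
      have h5 := abs_im_fatouFunction_le z
      have h6 := add_exp_le_fatouSize_succ n
      have h7 := Real.exp_pos (fatouSize n)
      have h8 := Real.pi_gt_three
      refine ⟨by linarith, ?_⟩
      have h9 : 2 * Real.pi * (fatouSize n + Real.exp (fatouSize n)) ≤
          2 * Real.pi * fatouSize (n + 1) := by gcongr
      nlinarith
  | succ m ih =>
    intro z hz
    rcases mem_fatouWeb_succ.1 hz with h | ⟨k, hk, h1, h2⟩
    · exact mem_fatouWeb_succ.2 (Or.inl h)
    · exact mem_fatouWeb_succ.2 (Or.inr ⟨k, hk, h1, ih (n + 1) h2⟩)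

theorem fatouWeb_subset_succ_right (m n : ℕ) : fatouWeb m n ⊆ fatouWeb m (n + 1) := by
  have hs : (fatouSize n : ℝ) ≤ fatouSize (n + 1) := by exact_mod_cast (fatouSize_lt_succ n).le
  induction m generalizing n with
  | zero =>
    rintro z ⟨h1, h2⟩
    refine ⟨by linarith, h2.trans_le ?_⟩
    gcongr
  | succ m ih =>
    intro z hz
    rcases mem_fatouWeb_succ.1 hz with h | ⟨k, hk, h1, h2⟩
    · exact mem_fatouWeb_succ.2
        (Or.inl (fatouBase_mono (by linarith) (fatouSize_lt_succ n).le h))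
    · refine mem_fatouWeb_succ.2 (Or.inr ⟨k, ?_, h1, ih (n + 1)
        (by exact_mod_cast (fatouSize_lt_succ (n + 1)).le) h2⟩)
      have := fatouSize_lt_succ n
      rw [Finset.mem_Ico] at hk ⊢
      omega

theorem isSimplyConnected_Ioo_reProdIm_Ioo {a b c d : ℝ} (hab : a < b) (hcd : c < d) :
    IsSimplyConnected (Ioo a b ×ℂ Ioo c d) := by
  refine (convex_reProdIm (convex_Ioo _ _) (convex_Ioo _ _)).isSimplyConnected
    ⟨⟨(a + b) / 2, (c + d) / 2⟩, ?_, ?_⟩ <;> constructor <;> simp only <;> linarith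

theorem two_pi_fatouSize_pos (n : ℕ) : 0 < 2 * Real.pi * fatouSize n := by
  have : (1 : ℝ) ≤ fatouSize n := by exact_mod_cast one_le_fatouSize n
  have := Real.pi_pos
  positivity

/-- The cut at `x < 1` is where the inverse branches are defined. Each pullback meets the base in
the pullback of the rectangle `R`, and different tracts are disjoint. -/
theorem isSimplyConnected_fatouWeb_inter (m n : ℕ) :
    IsSimplyConnected (fatouWeb m n ∩ {z | z.re < 1}) := by
  induction m generalizing n with
  | zero =>
    have h : fatouWeb 0 n ∩ {z | z.re < 1} =
        Ioo (-(fatouSize n : ℝ)) 1 ×ℂ Ioo (-(2 * Real.pi * fatouSize n))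
          (2 * Real.pi * fatouSize n) := by
      ext z
      constructor
      · rintro ⟨⟨h1, h2⟩, h3⟩
        exact ⟨⟨h1, h3⟩, abs_lt.1 h2⟩
      · rintro ⟨⟨h1, h3⟩, h2⟩
        exact ⟨⟨h1, abs_lt.2 h2⟩, h3⟩
    have h1 : (0 : ℝ) ≤ fatouSize n := Nat.cast_nonneg _
    have h2 := two_pi_fatouSize_pos n
    rw [h]
    exact isSimplyConnected_Ioo_reProdIm_Ioo (by linarith) (by linarith)
  | succ m ih =>
    have h : fatouWeb (m + 1) n ∩ {z | z.re < 1} =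
        (fatouBase (fatouSize n + 5) (fatouSize n) ∩ {z | z.re < 1}) ∪
          ⋃ k ∈ Finset.Ico (-(fatouSize n : ℤ)) (fatouSize n),
            fatouTract k ∩ fatouFunction ⁻¹' fatouWeb m (n + 1) := by
      have hsub : ⋃ k ∈ Finset.Ico (-(fatouSize n : ℤ)) (fatouSize n),
          fatouTract k ∩ fatouFunction ⁻¹' fatouWeb m (n + 1) ⊆ {z | z.re < 1} :=
        iUnion₂_subset fun k _ z hz => re_lt_of_re_lt zero_le_one hz.1.2.2
      rw [fatouWeb, union_inter_distrib_right, inter_eq_left.2 hsub]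
    have ho : IsOpen {z : ℂ | z.re < 1} := isOpen_lt Complex.continuous_re continuous_const
    rw [h]
    refine IsSimplyConnected.union_biUnion
      (isSimplyConnected_fatouBase (by positivity) (one_le_fatouSize n))
      ((isOpen_fatouBase _ _).inter ho) _
      (fun k _ => isSimplyConnected_fatouTract_inter k (ih (n + 1)))
      (fun k _ => (isOpen_fatouTract k).inter
        ((isOpen_fatouWeb m (n + 1)).preimage continuous_fatouFunction)) ?_ ?_
    · intro k hk
      set R := Ioo collarLevel 1 ×ℂ Ioo (-(2 * Real.pi * fatouSize (n + 1)))
          (2 * Real.pi * fatouSize (n + 1))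
      have hR : IsSimplyConnected R := by
        have h2 := two_pi_fatouSize_pos (n + 1)
        exact isSimplyConnected_Ioo_reProdIm_Ioo collarLevel_lt_one (by linarith)
      have heq : fatouBase (fatouSize n + 5) (fatouSize n) ∩ {z | z.re < 1} ∩
          (fatouTract k ∩ fatouFunction ⁻¹' fatouWeb m (n + 1)) =
            fatouTract k ∩ fatouFunction ⁻¹' R := by
        ext z
        constructor
        · rintro ⟨⟨h1, h2⟩, h3, h4⟩
          exact ⟨h3, ⟨h1.2.2, h3.2.2⟩, abs_lt.1 (fatouWeb_bounds h4).2⟩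
        · rintro ⟨h1, ⟨h2, h3⟩, h4⟩
          have h4 : |(fatouFunction z).im| < 2 * Real.pi * fatouSize (n + 1) := abs_lt.2 h4
          have h5 := half_lt_collarLevel
          have h6 : (0 : ℝ) ≤ fatouSize (n + 1) := Nat.cast_nonneg _
          exact ⟨⟨⟨re_gt_of_mem_fatouTract h1 hk (by linarith) h4,
            abs_im_lt_of_mem_fatouTract h1 hk, h2⟩, re_lt_of_re_lt zero_le_one h3⟩, h1,
            mem_fatouWeb_of_half_lt m (by linarith) h4⟩
      rw [heq]
      refine (isSimplyConnected_fatouTract_inter k ?_).isPathConnected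
      rwa [inter_eq_left.2]
      exact fun w hw => hw.1.2
    · rintro j - k - hjk z ⟨hj, hk⟩
      exact absurd (fatouTract_eq_of_mem hj.1 hk.1) hjk

/-! ### Limit domains and their boundaries -/

/-- The limit of the approximations `fatouWeb m n` as `m → ∞`. -/
def fatouDomain (n : ℕ) : Set ℂ := ⋃ m, fatouWeb m n

theorem isOpen_fatouDomain (n : ℕ) : IsOpen (fatouDomain n) :=
  isOpen_iUnion fun m => isOpen_fatouWeb m n

theorem fatouDomain_bounds {n : ℕ} {z : ℂ} (hz : z ∈ fatouDomain n) :
    -((fatouSize n : ℝ) + 5) < z.re ∧ |z.im| < 2 * Real.pi * fatouSize n := by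
  obtain ⟨m, hm⟩ := mem_iUnion.1 hz
  exact fatouWeb_bounds hm

theorem mem_fatouDomain_of_norm_lt {n : ℕ} {z : ℂ} (hz : ‖z‖ < fatouSize n) :
    z ∈ fatouDomain n := by
  have h1 := neg_abs_le z.re
  have h2 := Complex.abs_re_le_norm z
  have h3 := Complex.abs_im_le_norm z
  refine mem_iUnion.2 ⟨0, by linarith, ?_⟩
  nlinarith [Real.pi_gt_three, norm_nonneg z]

theorem mem_fatouDomain_of_map {n : ℕ} {z : ℂ} {k : ℤ}
    (hk : k ∈ Finset.Ico (-(fatouSize n : ℤ)) (fatouSize n)) (hz : z ∈ fatouTract k)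
    (h : fatouFunction z ∈ fatouDomain (n + 1)) : z ∈ fatouDomain n := by
  obtain ⟨m, hm⟩ := mem_iUnion.1 h
  exact mem_iUnion.2 ⟨m + 1, mem_fatouWeb_succ.2 (Or.inr ⟨k, hk, hz, hm⟩)⟩

/-- Non-escape gives `Re f z ≤ 0`, so near `z` the domain contains no base points, only tract
pullbacks. -/
theorem map_mem_closure_fatouDomain {n : ℕ} {z : ℂ} (hz : z ∈ closure (fatouDomain n))
    (hI : z ∉ escapingSet fatouFunction) :
    (∃ k ∈ Finset.Ico (-(fatouSize n : ℤ)) (fatouSize n), z ∈ fatouTract k) ∧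
      fatouFunction z ∈ closure (fatouDomain (n + 1)) := by
  have hre : (fatouFunction z).re < collarLevel := by
    by_contra! hh
    refine hI (mem_escapingSet_map_iff.1 (mem_escapingSet_of_re_pos ?_))
    linarith [half_lt_collarLevel]
  have him : |z.im| ≤ 2 * Real.pi * fatouSize n :=
    closure_minimal (fun w hw => (fatouDomain_bounds hw).2.le)
      (isClosed_le Complex.continuous_im.abs continuous_const) hz
  refine ⟨exists_mem_fatouTract_of_abs_im_le (hre.trans collarLevel_lt_one) him, ?_⟩
  have hN : IsOpen {w | (fatouFunction w).re < collarLevel} :=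
    isOpen_lt (Complex.continuous_re.comp continuous_fatouFunction) continuous_const
  refine map_mem_closure continuous_fatouFunction (hN.inter_closure ⟨hre, hz⟩) ?_
  rintro w ⟨hw, hwd⟩
  obtain ⟨m, hm⟩ := mem_iUnion.1 hwd
  -- Raising the depth by one makes the recursive description available even when `m = 0`.
  rcases mem_fatouWeb_succ.1 (fatouWeb_mono_left n m.le_succ hm) with h | ⟨k, -, -, h⟩
  · exact absurd h.2.2 (not_lt.2 (le_of_lt hw))
  · exact mem_iUnion.2 ⟨m, h⟩

theorem mem_fatouDomain_of_iterate {j n : ℕ} {z : ℂ} (hz : z ∈ closure (fatouDomain n))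
    (hI : z ∉ escapingSet fatouFunction) (hj : fatouFunction^[j] z ∈ fatouDomain (n + j)) :
    z ∈ fatouDomain n := by
  induction j generalizing n z with
  | zero => exact hj
  | succ j ih =>
    obtain ⟨⟨k, hk, hzk⟩, hcl⟩ := map_mem_closure_fatouDomain hz hI
    refine mem_fatouDomain_of_map hk hzk (ih hcl (by rwa [mem_escapingSet_map_iff]) ?_)
    rwa [show n + 1 + j = n + (j + 1) by omega]

/-- A late return to a bounded set at time `j` falls inside the disc of radius `fatouSize (n + j)`,
which `fatouDomain (n + j)` contains. -/
theorem mem_fatouDomain_of_mem_closure {n : ℕ} {z : ℂ} (hz : z ∈ closure (fatouDomain n))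
    (hI : z ∉ escapingSet fatouFunction) : z ∈ fatouDomain n := by
  obtain ⟨r, hr⟩ := exists_frequently_norm_le hI
  obtain ⟨N, hN⟩ := exists_nat_gt r
  obtain ⟨j, hjN, hj⟩ := hr N
  refine mem_fatouDomain_of_iterate hz hI (mem_fatouDomain_of_norm_lt (hj.trans_lt ?_))
  have h1 : (N : ℝ) ≤ j := by exact_mod_cast hjN
  have h2 : j ≤ fatouSize (n + j) := by
    have := lt_fatouSize (n + j)
    omega
  have h2 : (j : ℝ) ≤ fatouSize (n + j) := by exact_mod_cast h2
  linarith

/-- For `x > 1/2` the domain is the full strip, so a rectangle is glued to the part `x < 1` along a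
smaller rectangle. -/
theorem isSimplyConnected_fatouDomain_inter (n : ℕ) :
    IsSimplyConnected (fatouDomain n ∩ {z | z.re < fatouSize n + 1}) := by
  have hs : (1 : ℝ) ≤ fatouSize n := by exact_mod_cast one_le_fatouSize n
  have hpos := two_pi_fatouSize_pos n
  have ho : IsOpen {z : ℂ | z.re < 1} := isOpen_lt Complex.continuous_re continuous_const
  set R := Ioo (1 / 2) (fatouSize n + 1 : ℝ) ×ℂ Ioo (-(2 * Real.pi * fatouSize n))
      (2 * Real.pi * fatouSize n)
  have h : fatouDomain n ∩ {z | z.re < fatouSize n + 1} =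
      (⋃ m, fatouWeb m n ∩ {z | z.re < 1}) ∪ R := by
    ext z
    constructor
    · rintro ⟨h1, h2⟩
      rcases lt_or_ge z.re 1 with h3 | h3
      · obtain ⟨m, hm⟩ := mem_iUnion.1 h1
        exact Or.inl (mem_iUnion.2 ⟨m, hm, h3⟩)
      · exact Or.inr ⟨⟨by linarith, h2⟩, abs_lt.1 (fatouDomain_bounds h1).2⟩
    · rintro (h1 | ⟨h1, h2⟩)
      · obtain ⟨m, hm, h3⟩ := mem_iUnion.1 h1
        have h3 : z.re < 1 := h3
        exact ⟨mem_iUnion.2 ⟨m, hm⟩, by rw [mem_ofPred_eq]; linarith⟩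
      · exact ⟨mem_iUnion.2 ⟨0, mem_fatouWeb_of_half_lt 0 h1.1 (abs_lt.2 h2)⟩, h1.2⟩
  have hinter : (⋃ m, fatouWeb m n ∩ {z | z.re < 1}) ∩ R =
      Ioo (1 / 2) 1 ×ℂ Ioo (-(2 * Real.pi * fatouSize n)) (2 * Real.pi * fatouSize n) := by
    ext z
    constructor
    · rintro ⟨h1, h2, h3⟩
      obtain ⟨m, hm, h4⟩ := mem_iUnion.1 h1
      exact ⟨⟨h2.1, h4⟩, h3⟩
    · rintro ⟨h1, h2⟩
      refine ⟨mem_iUnion.2 ⟨0, mem_fatouWeb_of_half_lt 0 h1.1 (abs_lt.2 h2), h1.2⟩,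
        ⟨h1.1, ?_⟩, h2⟩
      have := h1.2
      linarith
  rw [h]
  refine IsSimplyConnected.union (IsSimplyConnected.iUnion_of_monotone
      (fun m => isSimplyConnected_fatouWeb_inter m n)
      (fun m => (isOpen_fatouWeb m n).inter ho)
      fun a b hab => inter_subset_inter_left _ (fatouWeb_mono_left n hab))
    (isSimplyConnected_Ioo_reProdIm_Ioo (by linarith) (by linarith))
    (isOpen_iUnion fun m => (isOpen_fatouWeb m n).inter ho) (isOpen_reProdIm_Ioo _ _ _ _) ?_
  rw [hinter]
  exact (isSimplyConnected_Ioo_reProdIm_Ioo (by norm_num) (by linarith)).isPathConnected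

theorem isBounded_fatouDomain_inter (n : ℕ) :
    Bornology.IsBounded (fatouDomain n ∩ {z | z.re < fatouSize n + 1}) := by
  refine isBounded_iff_forall_norm_le.2
    ⟨(fatouSize n + 5) + 2 * Real.pi * fatouSize n, ?_⟩
  rintro z ⟨h1, h2 : z.re < fatouSize n + 1⟩
  obtain ⟨h3, h4⟩ := fatouDomain_bounds h1
  refine (Complex.norm_le_abs_re_add_abs_im z).trans (add_le_add ?_ h4.le)
  rw [abs_le]
  constructor <;> linarith

theorem frontier_fatouDomain_inter_subset (n : ℕ) :
    frontier (fatouDomain n ∩ {z | z.re < fatouSize n + 1}) ⊆ escapingSet fatouFunction := by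
  have ho : IsOpen (fatouDomain n ∩ {z : ℂ | z.re < fatouSize n + 1}) :=
    (isOpen_fatouDomain n).inter (isOpen_lt Complex.continuous_re continuous_const)
  intro z hz
  rw [ho.frontier_eq] at hz
  by_contra hI
  refine hz.2 ⟨mem_fatouDomain_of_mem_closure (closure_mono inter_subset_left hz.1) hI, ?_⟩
  -- Points on the right-hand cut have positive real part and escape.
  by_contra hre
  rw [mem_ofPred_eq, not_lt] at hre
  have : (0 : ℝ) ≤ fatouSize n := Nat.cast_nonneg _
  exact hI (mem_escapingSet_of_re_pos (by linarith))

theorem theorem1p1 : IsSpidersWeb (escapingSet fatouFunction) := by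
  refine ⟨isConnected_escapingSet_fatouFunction,
    fun n => fatouDomain n ∩ {z | z.re < fatouSize n + 1}, fun n => ⟨?_, ?_, ?_⟩, fun n => ?_,
    frontier_fatouDomain_inter_subset, eq_univ_of_forall fun z => ?_⟩
  · exact (isOpen_fatouDomain n).inter (isOpen_lt Complex.continuous_re continuous_const)
  · exact isSimplyConnected_fatouDomain_inter n
  · exact isBounded_fatouDomain_inter n
  · have hs : (fatouSize n : ℝ) ≤ fatouSize (n + 1) := by
      exact_mod_cast (fatouSize_lt_succ n).le
    rintro z ⟨h1, h2 : z.re < fatouSize n + 1⟩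
    refine ⟨iUnion_mono (fun m => fatouWeb_subset_succ_right m n) h1, ?_⟩
    rw [mem_ofPred_eq]
    linarith
  · obtain ⟨n, hn⟩ := exists_nat_gt ‖z‖
    have h1 : (n : ℝ) ≤ fatouSize n := by exact_mod_cast (lt_fatouSize n).le
    refine mem_iUnion.2 ⟨n, mem_fatouDomain_of_norm_lt (hn.trans_le h1), ?_⟩
    have := (le_abs_self _).trans (Complex.abs_re_le_norm z)
    rw [mem_ofPred_eq]
    linarith
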